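/- Setting. A $*$-differential (exterior) algebra is a graded algebra $\Omega=\bigoplus_{n\ge 0}\Omega^n$ over $\mathbb{C}$ with wedge product $\wedge$, whose degree zero part is a unital $*$-algebra $B=\Omega^0$, with a linear map $\mathrm{d}:\Omega^n\to\Omega^{n+1}$ and an antilinear involution $*:\Omega^n\to\Omega^n$ such that $\mathrm{d}^2=0$, $\mathrm{d}(\omega\wedge\eta)=\mathrm{d}\omega\wedge\eta+(-1)^n\omega\wedge\mathrm{d}\eta$, $\mathrm{d}(\omega^*)=(\mathrm{d}\omega)^*$, $(\omega\wedge\eta)^*=(-1)^{nm}\eta^*\wedge\omega^*$ for $\omega\in\Omega^n$, $\eta\in\Omega^m$, and such that $\Omega^1$ is spanned by the elements $b\,\mathrm{d}c$ with $b,c\in B$. For a complex $*$-algebra $H$ we use on $H\otimes\Omega$ the product algebra structure, the operation $(h\otimes\omega)^*=h^*\otimes\omega^*$ and the map $\mathrm{id}\otimes\mathrm{d}$. Let $G$ be a finite group and let $\mathbb{C}G$ be its group algebra, with $g^*=g^{-1}$ and $\epsilon(g)=1$ for $g\in G$, and $\mathbb{C}G^+=\ker\epsilon$. In $\mathbb{C}G$-valued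 gauge theory over $B$ (for the universal calculus on $G$) the connections and gauge transformations are $$\mathcal{A}=\{\alpha\in\mathbb{C}G^+\otimes\Omega^1\mid\alpha^*=-\alpha\},\qquad \mathcal{G}=\{\gamma\in\mathbb{C}G\otimes B\mid(\epsilon\otimes\mathrm{id})\gamma=1,\ \gamma\gamma^*=\gamma^*\gamma=1\}.$$ In noncommutative $U(d)$-gauge theory over $B$ they are $$\mathcal{A}_{d}=\{\alpha\in M_d(\mathbb{C})\otimes\Omega^1\mid\alpha^*=-\alpha\},\qquad \mathcal{G}_{d}=\{\gamma\in M_d(\mathbb{C})\otimes B\mid\gamma\gamma^*=\gamma^*\gamma=1\},$$ where $*$ on $M_d(\mathbb{C})$ is the Hermitian conjugate. In both theories the gauge group acts on connections by $\alpha^\gamma=\gamma\alpha\gamma^*+\gamma(\mathrm{id}\otimes\mathrm{d})\gamma^*$, and the curvature is the anti-Hermitian 2-form $F(\alpha)=(\mathrm{id}\otimes\mathrm{d})\alpha+\alpha\wedge\alpha$, with values in $\mathbb{C}G^+\otimes\Omega^2$ and $M_d(\mathbb{C})\otimes\Omega^2$ respectively. Let $\hat G$ be the set of equivalence classes of irreducible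 unitary representations of $G$, choose for each class a representative $\rho:G\to U(d_\rho)$, extend it linearly to $\rho:\mathbb{C}G\to M_{d_\rho}(\mathbb{C})$, and write $1\in\hat G$ for the trivial class. Put $$\pi_\rho=\frac{d_\rho}{|G|}\sum_{g\in G}\mathrm{Tr}(\rho(g^{-1}))\,g,\qquad \iota_\rho:M_{d_\rho}(\mathbb{C})\to\mathbb{C}G,\quad \iota_\rho(a)=\frac{d_\rho}{|G|}\sum_{g\in G}\sum_{i,j}\rho(g^{-1})_{ji}a_{ij}\,g.$$ Proposition. (1) $\hat G$ is finite. The $\pi_\rho$ are central and satisfy $\pi_\rho^*=\pi_\rho$, $\pi_\rho\pi_{\rho'}=\delta_{\rho,\rho'}\pi_\rho$, $\sum_{\rho\in\hat G}\pi_\rho=1$ and $\epsilon(\pi_\rho)=\delta_{\rho,1}$. Each $\rho:\mathbb{C}G\to M_{d_\rho}(\mathbb{C})$ is a $*$-homomorphism, vanishes on $(\mathbb{C}G)\pi_{\rho'}$ for $\rho'\neq\rho$, and satisfies $\rho(\iota_\rho(a))=a$ and $\iota_\rho(\rho(x))=x\pi_\rho$ for all $a\in M_{d_\rho}(\mathbb{C})$,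 $x\in\mathbb{C}G$; so it restricts to an isomorphism $(\mathbb{C}G)\pi_\rho\cong M_{d_\rho}(\mathbb{C})$ with inverse $\iota_\rho$. (2) Let $n\ge0$ and let $\omega\in\mathbb{C}G^+\otimes\Omega^n$ be anti-Hermitian (in particular, let $\omega\in\mathcal{A}$ when $n=1$). Put $\omega_\rho=\omega(\pi_\rho\otimes1)$. Then $\omega_1=0$ and $\omega=\sum_{\rho\ne1}\omega_\rho$, and for every $\rho\neq 1$ the component $\omega_\rho$ is again an anti-Hermitian element of $\mathbb{C}G^+\otimes\Omega^n$ and $(\rho\otimes\mathrm{id})\omega_\rho=(\rho\otimes\mathrm{id})\omega$. (3) Let $\gamma\in\mathcal{G}$ and put $\gamma_\rho=\gamma(\pi_\rho\otimes1)$. Then $\gamma_1=\pi_1\otimes1$ and $\gamma=\pi_1\otimes1+\sum_{\rho\neq1}\gamma_\rho$, and for every $\rho\neq1$ one has $\gamma_\rho\gamma_\rho^*=\gamma_\rho^*\gamma_\rho=\pi_\rho\otimes1$ (the unit of the block of $\rho$) and $(\rho\otimes\mathrm{id})\gamma_\rho=(\rho\otimes\mathrm{id})\gamma$. (4) $\mathbb{C}G$-valued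 gauge theory over $B$ is the product of the noncommutative $U(d_\rho)$-gauge theories over $B$ for the nontrivial $\rho\in\hat G$. That is, for each $n\ge 0$ the map $\omega\mapsto((\rho\otimes\mathrm{id})\omega)_{\rho\ne1}$ is an additive bijection from the anti-Hermitian elements of $\mathbb{C}G^+\otimes\Omega^n$ onto the product over $\rho\ne1$ of the sets of anti-Hermitian elements of $M_{d_\rho}(\mathbb{C})\otimes\Omega^n$, with inverse $(\beta_\rho)_\rho\mapsto\sum_{\rho\neq1}(\iota_\rho\otimes\mathrm{id})\beta_\rho$; for $n=1$ this is a bijection $\mathcal{A}\cong\prod_{\rho\ne1}\mathcal{A}_{d_\rho}$. The map $\gamma\mapsto((\rho\otimes\mathrm{id})\gamma)_{\rho\neq1}$ is a group isomorphism $\mathcal{G}\cong\prod_{\rho\ne1}\mathcal{G}_{d_\rho}$, with inverse $(u_\rho)_\rho\mapsto\pi_1\otimes1+\sum_{\rho\ne1}(\iota_\rho\otimes\mathrm{id})u_\rho$. These bijections are compatible with the gauge actions and the curvatures: for all $\alpha\in\mathcal{A}$, $\gamma\in\mathcal{G}$ and $\rho\neq1$, $$(\rho\otimes\mathrm{id})(\alpha^\gamma)=\big((\rho\otimes\mathrm{id})\alpha\big)^{(\rho\otimes\mathrm{id})\gamma},\qquad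 (\rho\otimes\mathrm{id})F(\alpha)=F\big((\rho\otimes\mathrm{id})\alpha\big).$$ -/

import Mathlib

open scoped TensorProduct

/-! ### Star-exterior algebras

`A` is the total algebra of forms, internally graded by `Ω n`, so that `B = Ω 0` is the coordinate
algebra, and the product of `A` is the wedge product. -/

/-- A `*`-differential graded (exterior) algebra over `ℂ` with underlying graded algebra
`A = ⨁ₙ Ω n`; the coordinate `*`-algebra is `B = Ω 0`, and `Ω 1` is a first order calculus. -/
structure StarDGA {A : Type*} [Ring A] [Algebra ℂ A] (Ω : ℕ → Submodule ℂ A)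
    [GradedAlgebra Ω] where
  /-- the exterior differential -/
  d : A →ₗ[ℂ] A
  /-- the antilinear `*`-operation on forms -/
  conj : A →ₗ⋆[ℂ] A
  d_mem : ∀ (n : ℕ) (ω : A), ω ∈ Ω n → d ω ∈ Ω (n + 1)
  conj_mem : ∀ (n : ℕ) (ω : A), ω ∈ Ω n → conj ω ∈ Ω n
  d_d : ∀ ω : A, d (d ω) = 0
  leibniz : ∀ (n : ℕ) (ω η : A), ω ∈ Ω n → d (ω * η) = d ω * η + (-1 : ℂ) ^ n • (ω * d η)
  conj_conj : ∀ ω : A, conj (conj ω) = ω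
  conj_mul : ∀ (n m : ℕ) (ω η : A), ω ∈ Ω n → η ∈ Ω m →
    conj (ω * η) = (-1 : ℂ) ^ (n * m) • (conj η * conj ω)
  conj_d : ∀ ω : A, d (conj ω) = conj (d ω)
  /-- the map `B ⊗ B → Ω¹`, `b ⊗ c ↦ b dc`, is surjective -/
  span_d : Submodule.span ℂ {x : A | ∃ b ∈ Ω 0, ∃ c ∈ Ω 0, x = b * d c} = Ω 1

namespace NCGauge

noncomputable section

/-! ### Forms with values in a complex algebra `H` -/

section Forms

variable {H : Type*} [Ring H] [Algebra ℂ H]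
variable {A : Type*} [Ring A] [Algebra ℂ A]

/-- The subspace `L ⊗ Ωⁿ` of `H ⊗ A`, for a subspace `L` of `H`. -/
def valForms (Ω : ℕ → Submodule ℂ A) (L : Submodule ℂ H) (n : ℕ) : Submodule ℂ (H ⊗[ℂ] A) :=
  LinearMap.range (TensorProduct.mapIncl L (Ω n))

variable {Ω : ℕ → Submodule ℂ A}

theorem tmul_mem_valForms {L : Submodule ℂ H} {n : ℕ} {h : H} {ω : A} (hh : h ∈ L)
    (hω : ω ∈ Ω n) : h ⊗ₜ[ℂ] ω ∈ valForms Ω L n :=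
  ⟨(⟨h, hh⟩ : L) ⊗ₜ (⟨ω, hω⟩ : Ω n), rfl⟩

theorem valForms_induction {L : Submodule ℂ H} {n : ℕ} {p : H ⊗[ℂ] A → Prop}
    (h0 : p 0) (ht : ∀ h ∈ L, ∀ ω ∈ Ω n, p (h ⊗ₜ[ℂ] ω)) (ha : ∀ x y, p x → p y → p (x + y))
    {x : H ⊗[ℂ] A} (hx : x ∈ valForms Ω L n) : p x := by
  obtain ⟨z, rfl⟩ := hx
  induction z using TensorProduct.induction_on with
  | zero => simpa using h0
  | tmul h ω => exact ht h h.2 ω ω.2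
  | add x y hx hy => rw [map_add]; exact ha _ _ hx hy

theorem valForms_mono {L M : Submodule ℂ H} (h : L ≤ M) (n : ℕ) :
    valForms Ω L n ≤ valForms Ω M n := fun _ hx =>
  valForms_induction (p := fun x => x ∈ valForms Ω M n) (zero_mem _)
    (fun _ hh _ hω => tmul_mem_valForms (h hh) hω) (fun _ _ hx hy => add_mem hx hy) hx

theorem valForms_mul [GradedAlgebra Ω] {L M N : Submodule ℂ H}
    (hLM : ∀ a ∈ L, ∀ b ∈ M, a * b ∈ N) {n m : ℕ} {x y : H ⊗[ℂ] A}
    (hx : x ∈ valForms Ω L n) (hy : y ∈ valForms Ω M m) : x * y ∈ valForms Ω N (n + m) := by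
  refine valForms_induction (p := fun x => x * y ∈ valForms Ω N (n + m)) ?_ ?_ ?_ hx
  · simp
  · intro a ha ω hω
    refine valForms_induction (p := fun y => (a ⊗ₜ[ℂ] ω) * y ∈ valForms Ω N (n + m)) ?_ ?_ ?_ hy
    · simp
    · intro b hb η hη
      rw [Algebra.TensorProduct.tmul_mul_tmul]
      exact tmul_mem_valForms (hLM a ha b hb) (SetLike.mul_mem_graded hω hη)
    · intro x y hx hy; rw [mul_add]; exact add_mem hx hy
  · intro x y hx hy; rw [add_mul]; exact add_mem hx hy

theorem valForms_mul_top [GradedAlgebra Ω] {n m k : ℕ} (hk : n + m = k) {x y : H ⊗[ℂ] A}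
    (hx : x ∈ valForms Ω (⊤ : Submodule ℂ H) n) (hy : y ∈ valForms Ω (⊤ : Submodule ℂ H) m) :
    x * y ∈ valForms Ω (⊤ : Submodule ℂ H) k := by
  subst hk
  exact valForms_mul (fun _ _ _ _ => Submodule.mem_top) hx hy

theorem one_mem_valForms [GradedAlgebra Ω] : (1 : H ⊗[ℂ] A) ∈ valForms Ω (⊤ : Submodule ℂ H) 0 :=
  tmul_mem_valForms (Submodule.mem_top) SetLike.GradedOne.one_mem

end Forms

section Generic

variable (H : Type*) [Ring H] [Algebra ℂ H]
variable {A : Type*} [Ring A] [Algebra ℂ A] {Ω : ℕ → Submodule ℂ A} [GradedAlgebra Ω]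

theorem d_one (D : StarDGA Ω) : D.d 1 = 0 := by
  have h := D.leibniz 0 1 1 SetLike.GradedOne.one_mem
  simpa using h

variable (D : StarDGA Ω)

/-- `id ⊗ d` on `H ⊗ A`. -/
def extD : H ⊗[ℂ] A →ₗ[ℂ] H ⊗[ℂ] A := TensorProduct.map LinearMap.id D.d

variable {H}

theorem extD_tmul (h : H) (ω : A) : extD H D (h ⊗ₜ ω) = h ⊗ₜ D.d ω := rfl

theorem extD_mem {L : Submodule ℂ H} {n : ℕ} {x : H ⊗[ℂ] A} (hx : x ∈ valForms Ω L n) :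
    extD H D x ∈ valForms Ω L (n + 1) := by
  refine valForms_induction (p := fun x => extD H D x ∈ valForms Ω L (n + 1)) ?_ ?_ ?_ hx
  · simp
  · intro h hh ω hω
    exact tmul_mem_valForms hh (D.d_mem n ω hω)
  · intro x y hx hy; rw [map_add]; exact add_mem hx hy

theorem extD_one : extD H D 1 = 0 := by
  rw [Algebra.TensorProduct.one_def, extD_tmul, d_one, TensorProduct.tmul_zero]

theorem extD_mul {n : ℕ} {x : H ⊗[ℂ] A} (hx : x ∈ valForms Ω (⊤ : Submodule ℂ H) n)
    (y : H ⊗[ℂ] A) :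
    extD H D (x * y) = extD H D x * y + (-1 : ℂ) ^ n • (x * extD H D y) := by
  refine valForms_induction (p := fun x => extD H D (x * y) =
    extD H D x * y + (-1 : ℂ) ^ n • (x * extD H D y)) ?_ ?_ ?_ hx
  · simp
  · intro a _ ω hω
    induction y using TensorProduct.induction_on with
    | zero => simp
    | tmul b η =>
      simp only [Algebra.TensorProduct.tmul_mul_tmul, extD_tmul, D.leibniz n ω η hω,
        TensorProduct.tmul_add, TensorProduct.tmul_smul]
    | add y z hy hz =>
      simp only [mul_add, map_add, smul_add, hy, hz]; abel
  · intro x z hx hz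
    simp only [add_mul, map_add, smul_add, hx, hz]; abel

variable (H)
variable [StarRing H] [StarModule ℂ H]

/-- The antilinear `*`-operation `(h ⊗ ω)* = h* ⊗ ω*` on `H ⊗ A`. -/
def tstar : H ⊗[ℂ] A →ₗ⋆[ℂ] H ⊗[ℂ] A :=
  TensorProduct.map (starLinearEquiv ℂ (A := H)).toLinearMap D.conj

variable {H}

theorem tstar_tmul (h : H) (ω : A) : tstar H D (h ⊗ₜ ω) = star h ⊗ₜ D.conj ω := rfl

theorem tstar_tstar (x : H ⊗[ℂ] A) : tstar H D (tstar H D x) = x := by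
  induction x using TensorProduct.induction_on with
  | zero => simp
  | tmul a ω => rw [tstar_tmul, tstar_tmul, star_star, D.conj_conj]
  | add x y hx hy => rw [map_add, map_add, hx, hy]

theorem tstar_mem {L : Submodule ℂ H} (hL : ∀ a ∈ L, star a ∈ L) {n : ℕ} {x : H ⊗[ℂ] A}
    (hx : x ∈ valForms Ω L n) : tstar H D x ∈ valForms Ω L n := by
  refine valForms_induction (p := fun x => tstar H D x ∈ valForms Ω L n) ?_ ?_ ?_ hx
  · simp
  · intro h hh ω hω
    exact tmul_mem_valForms (hL h hh) (D.conj_mem n ω hω)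
  · intro x y hx hy; rw [map_add]; exact add_mem hx hy

theorem tstar_mul {n m : ℕ} {x y : H ⊗[ℂ] A} (hx : x ∈ valForms Ω (⊤ : Submodule ℂ H) n)
    (hy : y ∈ valForms Ω (⊤ : Submodule ℂ H) m) :
    tstar H D (x * y) = (-1 : ℂ) ^ (n * m) • (tstar H D y * tstar H D x) := by
  refine valForms_induction (p := fun x => tstar H D (x * y) =
    (-1 : ℂ) ^ (n * m) • (tstar H D y * tstar H D x)) ?_ ?_ ?_ hx
  · simp
  · intro a _ ω hω
    refine valForms_induction (p := fun y => tstar H D ((a ⊗ₜ[ℂ] ω) * y) =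
      (-1 : ℂ) ^ (n * m) • (tstar H D y * tstar H D (a ⊗ₜ[ℂ] ω))) ?_ ?_ ?_ hy
    · simp
    · intro b _ η hη
      simp only [Algebra.TensorProduct.tmul_mul_tmul, tstar_tmul, D.conj_mul n m ω η hω hη,
        star_mul, TensorProduct.tmul_smul]
    · intro y z hy hz
      simp only [mul_add, add_mul, map_add, smul_add, hy, hz]
  · intro x z hx hz
    simp only [add_mul, mul_add, map_add, smul_add, hx, hz]

theorem tstar_one : tstar H D 1 = 1 := by
  have h := tstar_mul D (one_mem_valForms (Ω := Ω) (H := H))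
    (tstar_mem D (fun _ _ => Submodule.mem_top) (one_mem_valForms (Ω := Ω) (H := H)))
  rw [one_mul, tstar_tstar] at h
  simpa using h.symm

theorem extD_tstar (x : H ⊗[ℂ] A) : extD H D (tstar H D x) = tstar H D (extD H D x) := by
  induction x using TensorProduct.induction_on with
  | zero => simp
  | tmul a ω => rw [tstar_tmul, extD_tmul, extD_tmul, tstar_tmul, D.conj_d]
  | add x y hx hy => simp only [map_add, hx, hy]

/-- The anti-Hermitian `L`-valued `n`-forms `{ω ∈ L ⊗ Ωⁿ | ω* = -ω}`. -/
def antiHermForms (L : Submodule ℂ H) (n : ℕ) : AddSubgroup (H ⊗[ℂ] A) where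
  carrier := {x | x ∈ valForms Ω L n ∧ tstar H D x = -x}
  add_mem' := by
    rintro x y ⟨hx, hx'⟩ ⟨hy, hy'⟩
    exact ⟨add_mem hx hy, by rw [map_add, hx', hy', neg_add]⟩
  zero_mem' := ⟨zero_mem _, by simp⟩
  neg_mem' := by
    rintro x ⟨hx, hx'⟩
    exact ⟨neg_mem hx, by rw [map_neg, hx']⟩

/-- The gauge transform `α^γ = γ α γ* + γ (id ⊗ d) γ*`. -/
def gaugeTransform (γ α : H ⊗[ℂ] A) : H ⊗[ℂ] A :=
  γ * α * tstar H D γ + γ * extD H D (tstar H D γ)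

/-- The curvature `F(α) = (id ⊗ d) α + α ∧ α`. -/
def curvatureForm (α : H ⊗[ℂ] A) : H ⊗[ℂ] A := extD H D α + α * α

theorem mem_antiHermForms {L : Submodule ℂ H} {n : ℕ} {x : H ⊗[ℂ] A} :
    x ∈ antiHermForms D L n ↔ x ∈ valForms Ω L n ∧ tstar H D x = -x := Iff.rfl

theorem curvatureForm_mem {L : Submodule ℂ H} (hL : ∀ a ∈ L, ∀ b ∈ L, a * b ∈ L)
    {α : H ⊗[ℂ] A} (hα : α ∈ antiHermForms D L 1) :
    curvatureForm D α ∈ antiHermForms D L 2 := by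
  rw [mem_antiHermForms] at hα ⊢
  obtain ⟨h1, h2⟩ := hα
  have h1' := valForms_mono (Ω := Ω) (le_top : L ≤ ⊤) 1 h1
  have h4 : α * α ∈ valForms Ω L (1 + 1) := valForms_mul (n := 1) (m := 1) hL h1 h1
  have h5 : extD H D α ∈ valForms Ω L 2 := extD_mem D h1
  refine ⟨add_mem h5 h4, ?_⟩
  have h3 := tstar_mul D h1' h1'
  rw [h2] at h3
  rw [curvatureForm, map_add, ← extD_tstar, h2, h3]
  simp only [map_neg, mul_one, pow_one, neg_mul_neg, neg_smul, one_smul, neg_add]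

theorem tstar_mul_zero {x y : H ⊗[ℂ] A} (hx : x ∈ valForms Ω (⊤ : Submodule ℂ H) 0)
    (hy : y ∈ valForms Ω (⊤ : Submodule ℂ H) 0) :
    tstar H D (x * y) = tstar H D y * tstar H D x := by
  have h := tstar_mul D hx hy
  rwa [mul_zero, pow_zero, one_smul] at h

theorem tstar_mem_top {n : ℕ} {x : H ⊗[ℂ] A} (hx : x ∈ valForms Ω (⊤ : Submodule ℂ H) n) :
    tstar H D x ∈ valForms Ω (⊤ : Submodule ℂ H) n :=
  tstar_mem D (fun _ _ => Submodule.mem_top) hx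

variable (H)

/-- The unitary elements of `H ⊗ B`, where `B = Ω⁰`. -/
def unitaryGauge : Submonoid (H ⊗[ℂ] A) where
  carrier := {γ | γ ∈ valForms Ω (⊤ : Submodule ℂ H) 0 ∧
    γ * tstar H D γ = 1 ∧ tstar H D γ * γ = 1}
  one_mem' := by
    rw [Set.mem_ofPred_eq, tstar_one, one_mul]
    exact ⟨one_mem_valForms, rfl, rfl⟩
  mul_mem' := by
    intro x y hx hy
    rw [Set.mem_ofPred_eq] at hx hy ⊢
    obtain ⟨hx, hx1, hx2⟩ := hx
    obtain ⟨hy, hy1, hy2⟩ := hy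
    have hxy : x * y ∈ valForms Ω (⊤ : Submodule ℂ H) 0 := valForms_mul_top (add_zero 0) hx hy
    refine ⟨hxy, ?_, ?_⟩
    · rw [tstar_mul_zero D hx hy, mul_assoc, ← mul_assoc y, hy1, one_mul, hx1]
    · rw [tstar_mul_zero D hx hy, mul_assoc, ← mul_assoc _ x, hx2, one_mul, hy2]

theorem mem_unitaryGauge {x : H ⊗[ℂ] A} : x ∈ unitaryGauge H D ↔
    x ∈ valForms Ω (⊤ : Submodule ℂ H) 0 ∧ x * tstar H D x = 1 ∧ tstar H D x * x = 1 := Iff.rfl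

theorem tstar_mem_unitaryGauge {x : H ⊗[ℂ] A} (hx : x ∈ unitaryGauge H D) :
    tstar H D x ∈ unitaryGauge H D := by
  rw [mem_unitaryGauge] at hx ⊢
  rw [tstar_tstar]
  exact ⟨tstar_mem_top D hx.1, hx.2.2, hx.2.1⟩

/-- The unitary elements form a group, with inverse `γ⁻¹ = γ*`. -/
instance unitaryGroup : Group (unitaryGauge H D) where
  inv γ := ⟨tstar H D γ.1, tstar_mem_unitaryGauge H D γ.2⟩
  inv_mul_cancel γ := Subtype.ext ((mem_unitaryGauge H D).1 γ.2).2.2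

variable {H}

theorem gaugeTransform_one (α : H ⊗[ℂ] A) : gaugeTransform D 1 α = α := by
  simp [gaugeTransform, tstar_one, extD_one]

theorem gaugeTransform_mul (γ δ : unitaryGauge H D) (α : H ⊗[ℂ] A) :
    gaugeTransform D (γ * δ : unitaryGauge H D).1 α =
      gaugeTransform D γ.1 (gaugeTransform D δ.1 α) := by
  obtain ⟨γ, hγ'⟩ := γ
  obtain ⟨δ, hδ'⟩ := δ
  obtain ⟨hγ, hγ1, hγ2⟩ := (mem_unitaryGauge H D).1 hγ'
  obtain ⟨hδ, hδ1, hδ2⟩ := (mem_unitaryGauge H D).1 hδ'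
  have h := tstar_mul_zero D hγ hδ
  have h2 := extD_mul D (tstar_mem_top D hδ) (tstar H D γ)
  rw [pow_zero, one_smul] at h2
  simp only [gaugeTransform, Submonoid.mk_mul_mk, h, h2]
  have h3 : γ * δ * (tstar H D δ * extD H D (tstar H D γ)) = γ * extD H D (tstar H D γ) := by
    rw [mul_assoc γ, ← mul_assoc δ, hδ1, one_mul]
  rw [mul_add, h3]
  simp only [mul_add, add_mul, mul_assoc, add_assoc]

theorem gaugeTransform_mem (γ : unitaryGauge H D) {α : H ⊗[ℂ] A}
    (hα : α ∈ antiHermForms D (⊤ : Submodule ℂ H) 1) :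
    gaugeTransform D γ.1 α ∈ antiHermForms D (⊤ : Submodule ℂ H) 1 := by
  obtain ⟨γ, hγ'⟩ := γ
  obtain ⟨hγ, hγ1, hγ2⟩ := (mem_unitaryGauge H D).1 hγ'
  rw [mem_antiHermForms] at hα ⊢
  obtain ⟨h1, h2⟩ := hα
  have hs := tstar_mem_top D hγ
  have hd := extD_mem D hs
  have hγα : γ * α ∈ valForms Ω (⊤ : Submodule ℂ H) 1 := valForms_mul_top (zero_add 1) hγ h1
  have m1 : γ * α * tstar H D γ ∈ valForms Ω (⊤ : Submodule ℂ H) 1 :=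
    valForms_mul_top (add_zero 1) hγα hs
  have m2 : γ * extD H D (tstar H D γ) ∈ valForms Ω (⊤ : Submodule ℂ H) 1 :=
    valForms_mul_top (zero_add 1) hγ hd
  refine ⟨add_mem m1 m2, ?_⟩
  have e0 := tstar_mul D hγ h1
  rw [zero_mul, pow_zero, one_smul, h2] at e0
  have e1 := tstar_mul D hγα hs
  rw [mul_zero, pow_zero, one_smul, tstar_tstar, e0, neg_mul, mul_neg, ← mul_assoc] at e1
  have e2 := tstar_mul D hγ hd
  rw [zero_mul, pow_zero, one_smul, ← extD_tstar, tstar_tstar] at e2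
  have e3 := extD_mul D hγ (tstar H D γ)
  rw [hγ1, extD_one, pow_zero, one_smul] at e3
  rw [gaugeTransform, map_add, e1, e2, neg_add, eq_neg_of_add_eq_zero_left e3.symm]

end Generic

/-! ### Noncommutative `U(d)`-gauge theory -/

section Ud

variable {A : Type*} [Ring A] [Algebra ℂ A] {Ω : ℕ → Submodule ℂ A} [GradedAlgebra Ω]
variable (D : StarDGA Ω) (d : ℕ)

/-- Anti-Hermitian elements of `M_d(ℂ) ⊗ Ωⁿ`. -/
abbrev UdForms (n : ℕ) : AddSubgroup (Matrix (Fin d) (Fin d) ℂ ⊗[ℂ] A) :=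
  antiHermForms D (⊤ : Submodule ℂ (Matrix (Fin d) (Fin d) ℂ)) n

/-- Connections of noncommutative `U(d)`-gauge theory: `α ∈ M_d(ℂ) ⊗ Ω¹` with `α* = -α`. -/
abbrev UdConnection : AddSubgroup (Matrix (Fin d) (Fin d) ℂ ⊗[ℂ] A) := UdForms D d 1

/-- Gauge transformations of noncommutative `U(d)`-gauge theory: the group of unitaries of
`M_d(ℂ) ⊗ B`. -/
abbrev UdGauge : Submonoid (Matrix (Fin d) (Fin d) ℂ ⊗[ℂ] A) :=
  unitaryGauge (Matrix (Fin d) (Fin d) ℂ) D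

/-- The action `(γ, α) ↦ α^γ` of gauge transformations on connections. -/
instance udAction : MulAction (UdGauge D d) (UdConnection D d) where
  smul γ α := ⟨gaugeTransform D γ.1 α.1, gaugeTransform_mem D γ α.2⟩
  one_smul α := Subtype.ext (gaugeTransform_one D α.1)
  mul_smul γ δ α := Subtype.ext (gaugeTransform_mul D γ δ α.1)

/-- The curvature of a `U(d)`-connection. -/
def udCurvature (α : UdConnection D d) : UdForms D d 2 :=
  ⟨curvatureForm D α.1, curvatureForm_mem D (fun _ _ _ _ => Submodule.mem_top) α.2⟩

end Ud

/-! ### `ℂG`-valued gauge theory for the universal calculus on `G` -/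

section Counit

variable (G : Type*) [Group G]

/-- `ℂG⁺ = ker ε`. -/
def augmentation : Submodule ℂ (MonoidAlgebra ℂ G) :=
  LinearMap.ker (Bialgebra.counitAlgHom ℂ (MonoidAlgebra ℂ G)).toLinearMap

theorem augmentation_mul (a : MonoidAlgebra ℂ G) (ha : a ∈ augmentation G) (b : MonoidAlgebra ℂ G)
    (_ : b ∈ augmentation G) : a * b ∈ augmentation G := by
  have ha' : Bialgebra.counitAlgHom ℂ (MonoidAlgebra ℂ G) a = 0 := ha
  change Bialgebra.counitAlgHom ℂ (MonoidAlgebra ℂ G) (a * b) = 0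
  rw [map_mul, ha', zero_mul]

variable (A : Type*) [Ring A] [Algebra ℂ A]

/-- `ε ⊗ id : ℂG ⊗ A → ℂ ⊗ A = A`. -/
def counitMap : MonoidAlgebra ℂ G ⊗[ℂ] A →ₐ[ℂ] A :=
  (Algebra.TensorProduct.lid ℂ A).toAlgHom.comp
    (Algebra.TensorProduct.map (Bialgebra.counitAlgHom ℂ (MonoidAlgebra ℂ G)) (AlgHom.id ℂ A))

variable {A}

theorem counitMap_tmul (x : MonoidAlgebra ℂ G) (ω : A) :
    counitMap G A (x ⊗ₜ ω) = Bialgebra.counitAlgHom ℂ (MonoidAlgebra ℂ G) x • ω := by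
  simp [counitMap]

theorem mem_valForms_augmentation {Ω : ℕ → Submodule ℂ A} {n : ℕ} {x : MonoidAlgebra ℂ G ⊗[ℂ] A} :
    x ∈ valForms Ω (augmentation G) n ↔
      x ∈ valForms Ω (⊤ : Submodule ℂ (MonoidAlgebra ℂ G)) n ∧ counitMap G A x = 0 := by
  constructor
  · intro hx
    refine ⟨valForms_mono le_top n hx, ?_⟩
    refine valForms_induction (p := fun x => counitMap G A x = 0) (map_zero _) ?_ ?_ hx
    · intro h hh ω _
      have : Bialgebra.counitAlgHom ℂ (MonoidAlgebra ℂ G) h = 0 := hh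
      rw [counitMap_tmul, this, zero_smul]
    · intro x y hx hy; rw [map_add, hx, hy, add_zero]
  · rintro ⟨hx, h0⟩
    have key : x - 1 ⊗ₜ counitMap G A x ∈ valForms Ω (augmentation G) n := by
      refine valForms_induction (p := fun x => x - 1 ⊗ₜ counitMap G A x ∈
        valForms Ω (augmentation G) n) (by simp) ?_ ?_ hx
      · intro h _ ω hω
        rw [counitMap_tmul, ← TensorProduct.smul_tmul, ← TensorProduct.sub_tmul]
        refine tmul_mem_valForms ?_ hω
        change Bialgebra.counitAlgHom ℂ (MonoidAlgebra ℂ G) _ = 0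
        rw [map_sub, map_smul, map_one, smul_eq_mul, mul_one, sub_self]
      · intro x y hx hy
        rw [map_add, TensorProduct.tmul_add, add_sub_add_comm]
        exact add_mem hx hy
    simpa [h0] using key

end Counit

section GroupAlgebra

variable (G : Type*) [Group G] [Fintype G]

variable {G} in
/-- The coefficientwise formula for the antilinear extension of `g* = g⁻¹` to `ℂG`. -/
def groupStar (x : MonoidAlgebra ℂ G) : MonoidAlgebra ℂ G :=
  ∑ g : G, MonoidAlgebra.single g⁻¹ (starRingEnd ℂ (x.coeff g))

theorem groupStar_single (g : G) (a : ℂ) :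
    groupStar (MonoidAlgebra.single g a) = MonoidAlgebra.single g⁻¹ (starRingEnd ℂ a) := by
  classical
  rw [groupStar, Finset.sum_eq_single g]
  · simp
  · intro h _ hh
    simp [hh.symm]
  · simp

theorem groupStar_add (x y : MonoidAlgebra ℂ G) :
    groupStar (x + y) = groupStar x + groupStar y := by
  simp [groupStar, Finset.sum_add_distrib]

/-- The `*`-algebra structure of `ℂG`, given by `(∑ a_g g)* = ∑ (conj a_g) g⁻¹`. -/
instance : StarRing (MonoidAlgebra ℂ G) where
  star := groupStar
  star_involutive x := by
    induction x using MonoidAlgebra.induction_linear with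
    | zero => simp [groupStar]
    | add x y hx hy => rw [groupStar_add, groupStar_add, hx, hy]
    | single g a => simp [groupStar_single]
  star_mul x y := by
    induction x using MonoidAlgebra.induction_linear with
    | zero => simp [groupStar]
    | add x z hx hz => simp only [add_mul, mul_add, groupStar_add, hx, hz]
    | single g a =>
      induction y using MonoidAlgebra.induction_linear with
      | zero => simp [groupStar]
      | add x z hx hz => simp only [add_mul, mul_add, groupStar_add, hx, hz]
      | single h b => simp [groupStar_single, MonoidAlgebra.single_mul_single, mul_comm]
  star_add := groupStar_add G

theorem star_single (g : G) (a : ℂ) :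
    star (MonoidAlgebra.single g a) = MonoidAlgebra.single g⁻¹ (star a) := groupStar_single G g a

instance : StarModule ℂ (MonoidAlgebra ℂ G) where
  star_smul c x := by
    induction x using MonoidAlgebra.induction_linear with
    | zero => simp
    | add x y hx hy => simp only [smul_add, star_add, hx, hy]
    | single g a => simp [star_single, MonoidAlgebra.smul_single]

variable {A : Type*} [Ring A] [Algebra ℂ A]
variable {Ω : ℕ → Submodule ℂ A} [GradedAlgebra Ω] (D : StarDGA Ω)

theorem counitMap_extD (x : MonoidAlgebra ℂ G ⊗[ℂ] A) :
    counitMap G A (extD _ D x) = D.d (counitMap G A x) := by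
  induction x using TensorProduct.induction_on with
  | zero => simp
  | tmul a ω => rw [extD_tmul, counitMap_tmul, counitMap_tmul, map_smul]
  | add x y hx hy => simp only [map_add, hx, hy]

/-- Anti-Hermitian elements of `ℂG⁺ ⊗ Ωⁿ`. -/
abbrev GroupForms (n : ℕ) : AddSubgroup (MonoidAlgebra ℂ G ⊗[ℂ] A) :=
  antiHermForms D (augmentation G) n

/-- Connections of `ℂG`-valued gauge theory: `α ∈ ℂG⁺ ⊗ Ω¹` with `α* = -α`. -/
abbrev GroupConnection : AddSubgroup (MonoidAlgebra ℂ G ⊗[ℂ] A) := GroupForms G D 1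

/-- Gauge transformations of `ℂG`-valued gauge theory: the group of unitaries `γ ∈ ℂG ⊗ B` with
`(ε ⊗ id) γ = 1`. -/
def GroupGauge : Subgroup (unitaryGauge (MonoidAlgebra ℂ G) D) where
  carrier := {γ | counitMap G A γ.1 = 1}
  one_mem' := map_one (counitMap G A)
  mul_mem' := by
    intro γ δ (hγ : counitMap G A γ.1 = 1) (hδ : counitMap G A δ.1 = 1)
    change counitMap G A (γ.1 * δ.1) = 1
    rw [map_mul, hγ, hδ, one_mul]
  inv_mem' := by
    intro γ (hγ : counitMap G A γ.1 = 1)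
    change counitMap G A (γ⁻¹).1 = 1
    have h : counitMap G A (γ * γ⁻¹ : unitaryGauge (MonoidAlgebra ℂ G) D).1 = 1 := by
      rw [mul_inv_cancel]
      exact map_one (counitMap G A)
    rw [Submonoid.coe_mul] at h
    rwa [map_mul, hγ, one_mul] at h

theorem gaugeTransform_mem_group (γ : GroupGauge G D) (α : GroupConnection G D) :
    gaugeTransform D γ.1.1 α.1 ∈ GroupConnection G D := by
  obtain ⟨α, hα⟩ := α
  rw [mem_antiHermForms] at hα
  have hα1 := (mem_valForms_augmentation G).1 hα.1
  have h := gaugeTransform_mem D γ.1 ((mem_antiHermForms D).2 ⟨hα1.1, hα.2⟩)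
  rw [mem_antiHermForms] at h ⊢
  refine ⟨(mem_valForms_augmentation G).2 ⟨h.1, ?_⟩, h.2⟩
  have h1 : counitMap G A γ.1.1 = 1 := γ.2
  have h2 : counitMap G A (tstar _ D γ.1.1) = 1 := (γ⁻¹).2
  rw [gaugeTransform, map_add, map_mul, map_mul, map_mul, hα1.2, counitMap_extD, h1, h2, d_one]
  simp

/-- The action `(γ, α) ↦ α^γ` of gauge transformations on connections. -/
instance groupAction : MulAction (GroupGauge G D) (GroupConnection G D) where
  smul γ α := ⟨gaugeTransform D γ.1.1 α.1, gaugeTransform_mem_group G D γ α⟩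
  one_smul α := Subtype.ext (gaugeTransform_one D α.1)
  mul_smul γ δ α := Subtype.ext (gaugeTransform_mul D γ.1 δ.1 α.1)

/-- The curvature of a `ℂG`-valued connection. -/
def groupCurvature (α : GroupConnection G D) : GroupForms G D 2 :=
  ⟨curvatureForm D α.1, curvatureForm_mem D (augmentation_mul G) α.2⟩

end GroupAlgebra

/-! ### The unitary dual of `G` -/

/-- The representation of `G` on `ℂ^d` given by a homomorphism `G → U(d)`. -/
def unitaryRep {G : Type*} [Group G] {d : ℕ} (f : G →* Matrix.unitaryGroup (Fin d) ℂ) :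
    Representation ℂ G (Fin d → ℂ) :=
  (Matrix.toLinAlgEquiv' (R := ℂ) (n := Fin d)).toMonoidHom.comp
    ((Matrix.unitaryGroup (Fin d) ℂ).subtype.comp f)

/-- An irreducible unitary matrix representation `G → U(dim)`. -/
structure UnitaryIrrep (G : Type*) [Group G] where
  /-- the dimension `d_ρ` -/
  dim : ℕ
  /-- the homomorphism `G → U(d_ρ)` -/
  hom : G →* Matrix.unitaryGroup (Fin dim) ℂ
  irreducible : (unitaryRep hom).IsIrreducible

section Dual

variable {G : Type*} [Group G]

/-- The linear extension `ρ : ℂG → M_{d_ρ}(ℂ)`. -/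
def UnitaryIrrep.toAlgHom (ρ : UnitaryIrrep G) :
    MonoidAlgebra ℂ G →ₐ[ℂ] Matrix (Fin ρ.dim) (Fin ρ.dim) ℂ :=
  MonoidAlgebra.lift ℂ _ G ((Matrix.unitaryGroup (Fin ρ.dim) ℂ).subtype.comp ρ.hom)

/-- `ρ ⊗ id : ℂG ⊗ A → M_{d_ρ}(ℂ) ⊗ A`. -/
def UnitaryIrrep.block (ρ : UnitaryIrrep G) (A : Type*) [Ring A] [Algebra ℂ A] :
    MonoidAlgebra ℂ G ⊗[ℂ] A →ₐ[ℂ] Matrix (Fin ρ.dim) (Fin ρ.dim) ℂ ⊗[ℂ] A :=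
  Algebra.TensorProduct.map ρ.toAlgHom (AlgHom.id ℂ A)

variable [Fintype G]

/-- `π_ρ = (d_ρ / |G|) ∑_g Tr(ρ(g⁻¹)) g`. -/
def UnitaryIrrep.proj (ρ : UnitaryIrrep G) : MonoidAlgebra ℂ G :=
  ((ρ.dim : ℂ) / (Fintype.card G : ℂ)) •
    ∑ g : G, MonoidAlgebra.single g (Matrix.trace (ρ.hom g⁻¹ : Matrix (Fin ρ.dim) (Fin ρ.dim) ℂ))

/-- The map `a ↦ (d_ρ / |G|) ∑_g (∑_{ij} ρ(g⁻¹)_{ji} a_{ij}) g` from `M_{d_ρ}(ℂ)` to `ℂG`. -/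
def UnitaryIrrep.embed (ρ : UnitaryIrrep G) :
    Matrix (Fin ρ.dim) (Fin ρ.dim) ℂ →ₗ[ℂ] MonoidAlgebra ℂ G where
  toFun a := ((ρ.dim : ℂ) / (Fintype.card G : ℂ)) •
    ∑ g : G, MonoidAlgebra.single g
      (∑ i, ∑ j, (ρ.hom g⁻¹ : Matrix (Fin ρ.dim) (Fin ρ.dim) ℂ) j i * a i j)
  map_add' a b := by
    simp only [Matrix.add_apply, mul_add, Finset.sum_add_distrib, MonoidAlgebra.single_add,
      smul_add]
  map_smul' c a := by
    rw [RingHom.id_apply, smul_comm c, Finset.smul_sum (r := c)]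
    simp only [MonoidAlgebra.smul_single, Matrix.smul_apply, smul_eq_mul, Finset.mul_sum,
      mul_left_comm]

/-- `embed ⊗ id : M_{d_ρ}(ℂ) ⊗ A → ℂG ⊗ A`. -/
def UnitaryIrrep.embedBlock (ρ : UnitaryIrrep G) (A : Type*) [Ring A] [Algebra ℂ A] :
    Matrix (Fin ρ.dim) (Fin ρ.dim) ℂ ⊗[ℂ] A →ₗ[ℂ] MonoidAlgebra ℂ G ⊗[ℂ] A :=
  TensorProduct.map ρ.embed LinearMap.id

/-- `π_ρ ⊗ 1 ∈ ℂG ⊗ A`. -/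
def UnitaryIrrep.projTensor (ρ : UnitaryIrrep G) (A : Type*) [Ring A] [Algebra ℂ A] :
    MonoidAlgebra ℂ G ⊗[ℂ] A :=
  ρ.proj ⊗ₜ 1

end Dual

variable (G : Type*) [Group G]

/-- Equivalence of unitary irreps, as representations. -/
instance unitaryIrrepSetoid : Setoid (UnitaryIrrep G) where
  r ρ σ := Nonempty (Representation.Equiv (unitaryRep ρ.hom) (unitaryRep σ.hom))
  iseqv := ⟨fun _ => ⟨.refl _⟩, fun ⟨e⟩ => ⟨e.symm⟩, fun ⟨e⟩ ⟨f⟩ => ⟨e.trans f⟩⟩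

/-- The set `Ĝ` of equivalence classes of unitary irreps. -/
def UnitaryDual := Quotient (unitaryIrrepSetoid G)

/-- The trivial irrep `G → U(1)`. -/
def trivialIrrep : UnitaryIrrep G where
  dim := 1
  hom := 1
  irreducible := by
    have h : IsSimpleOrder (Submodule ℂ (Fin 1 → ℂ)) :=
      (isSimpleModule_iff ℂ (Fin 1 → ℂ)).1 (isSimpleModule_iff_finrank_eq_one.2 (by simp))
    refine { exists_pair_ne := ⟨⊥, ⊤, fun e => ?_⟩, eq_bot_or_eq_top := fun W => ?_ }
    · exact bot_ne_top (congrArg Subrepresentation.toSubmodule e)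
    · rcases h.eq_bot_or_eq_top W.toSubmodule with e | e
      · exact Or.inl (Subrepresentation.toSubmodule_injective e)
      · exact Or.inr (Subrepresentation.toSubmodule_injective e)

/-- The class `1 ∈ Ĝ` of the trivial irrep. -/
def trivialClass : UnitaryDual G := Quotient.mk _ (trivialIrrep G)

/-- The nontrivial classes `Ĝ ∖ {1}`. -/
abbrev NontrivialDual := {c : UnitaryDual G // c ≠ trivialClass G}

end

end NCGauge

/-! The theorem is Fourier analysis on the finite group `G`, tensored with the algebra of forms.
Schur orthogonality says that `embed` is a right inverse of `toAlgHom` for the same irrep and is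
killed by every inequivalent one (`UnitaryIrrep.toAlgHom_embed`,
`UnitaryIrrep.toAlgHom_embed_of_not_equiv`). A translation of the summation variable gives the other
composite: `embed` after `toAlgHom` is multiplication by `proj`, from the right and equally from the
left. Centrality, idempotency and orthogonality of the `proj` are then formal, and unitarity of the
representations makes `toAlgHom` and `embed` respect `*`.

Completeness, that the `proj` add up to 1, needs enough irreps. By semisimplicity the regular module
is a sum of simple modules; each of these is finite dimensional, hence unitarizable by averaging an
inner product, so an element that vanishes in all unitary irreps is zero
(`eq_zero_of_toAlgHom_eq_zero`). Finiteness of the dual is the linear independence of the `proj` in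
a finite dimensional space.

On `ℂG ⊗ A` this yields `ext_blocks`: an element is determined by its image under `ε ⊗ id`, which is
its trivial block, and by its nontrivial blocks. The condition defining forms with values in `ℂG⁺`
sets the trivial block to 0, and the normalization of gauge transformations sets it to 1, so only
the nontrivial blocks remain, and these are arbitrary. The maps `ρ ⊗ id` are algebra homomorphisms
commuting with `*` and `id ⊗ d`, hence with everything built from these, in particular the gauge
action and the curvature. -/

namespace NCGauge

/-! ### Schur orthogonality and the central projections of the group algebra -/

section SchurOrthogonality

variable {G : Type*} [Group G]

theorem unitaryRep_apply {d : ℕ} (f : G →* Matrix.unitaryGroup (Fin d) ℂ) (g : G)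
    (v : Fin d → ℂ) : unitaryRep f g v = (f g).1.mulVec v := rfl

theorem UnitaryIrrep.toAlgHom_single (ρ : UnitaryIrrep G) (g : G) (a : ℂ) :
    ρ.toAlgHom (MonoidAlgebra.single g a) = a • (ρ.hom g).1 := by
  simp [UnitaryIrrep.toAlgHom]

/-- Irreducibility excludes the zero space, whose lattice of subrepresentations is trivial. This
allows division by `d_ρ` and the use of the matrix entry at `(0, 0)`. -/
theorem UnitaryIrrep.dim_pos (ρ : UnitaryIrrep G) : 0 < ρ.dim := by
  rcases Nat.eq_zero_or_pos ρ.dim with h | h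
  · exfalso
    have := ρ.irreducible
    have hs : Subsingleton (Fin ρ.dim → ℂ) := by rw [h]; infer_instance
    obtain ⟨x, y, hxy⟩ := exists_pair_ne (Subrepresentation (unitaryRep ρ.hom))
    exact hxy (Subrepresentation.toSubmodule_injective (Subsingleton.elim _ _))
  · exact h

theorem val_inv_eq_star {d : ℕ} (f : G →* Matrix.unitaryGroup (Fin d) ℂ) (g : G) :
    (f g⁻¹).1 = star (f g).1 := by
  rw [map_inv]; rfl

/-- A matrix intertwining two unitary representations, as an intertwining map. -/
noncomputable def matrixIntertwining {m n : ℕ} (f : G →* Matrix.unitaryGroup (Fin m) ℂ)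
    (f' : G →* Matrix.unitaryGroup (Fin n) ℂ) (X : Matrix (Fin n) (Fin m) ℂ)
    (hX : ∀ g, X * (f g).1 = (f' g).1 * X) :
    (unitaryRep f).IntertwiningMap (unitaryRep f') where
  toLinearMap := Matrix.toLin' X
  isIntertwining' g := by
    refine LinearMap.ext fun v => ?_
    change X.mulVec ((f g).1.mulVec v) = (f' g).1.mulVec (X.mulVec v)
    rw [Matrix.mulVec_mulVec, Matrix.mulVec_mulVec, hX]

/-- Schur's lemma: a nonzero intertwiner of irreducibles is bijective and would make them
equivalent. -/
theorem intertwining_eq_zero {ρ σ : UnitaryIrrep G} (h : ¬ ρ ≈ σ)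
    (X : Matrix (Fin σ.dim) (Fin ρ.dim) ℂ) (hX : ∀ g, X * (ρ.hom g).1 = (σ.hom g).1 * X) :
    X = 0 := by
  have := ρ.irreducible
  have := σ.irreducible
  rcases Representation.IsIrreducible.bijective_or_eq_zero
    (matrixIntertwining ρ.hom σ.hom X hX) with hb | h0
  · exact absurd ⟨Representation.IntertwiningMap.ofBijective _ hb⟩ h
  · have h1 := congrArg Representation.IntertwiningMap.toLinearMap h0
    exact (LinearEquiv.map_eq_zero_iff Matrix.toLin').1 h1

/-- Schur's lemma for endomorphisms, where `ℂ` being algebraically closed matters. -/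
theorem intertwining_eq_smul_one (ρ : UnitaryIrrep G) (X : Matrix (Fin ρ.dim) (Fin ρ.dim) ℂ)
    (hX : ∀ g, X * (ρ.hom g).1 = (ρ.hom g).1 * X) : ∃ c : ℂ, X = c • 1 := by
  have := ρ.irreducible
  obtain ⟨c, hc⟩ :=
    (Representation.IsIrreducible.algebraMap_intertwiningMap_bijective_of_isAlgClosed
      (ρ := unitaryRep ρ.hom)).2 (matrixIntertwining ρ.hom ρ.hom X hX)
  refine ⟨c, Matrix.toLin'.injective ?_⟩
  have h1 := congrArg Representation.IntertwiningMap.toLinearMap hc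
  refine h1.symm.trans (LinearMap.ext fun v => ?_)
  rw [map_smul, Matrix.toLin'_one]
  rfl

variable [Fintype G]

/-- The average `∑_g σ(g) X ρ(g⁻¹)` intertwines `ρ` and `σ`. -/
theorem sum_conj_intertwining (ρ σ : UnitaryIrrep G) (X : Matrix (Fin σ.dim) (Fin ρ.dim) ℂ)
    (h : G) : (∑ g, (σ.hom g).1 * X * (ρ.hom g⁻¹).1) * (ρ.hom h).1 =
      (σ.hom h).1 * ∑ g, (σ.hom g).1 * X * (ρ.hom g⁻¹).1 := by
  rw [Matrix.sum_mul, Matrix.mul_sum, ← Equiv.sum_comp (Equiv.mulLeft h⁻¹)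
    (fun g => (σ.hom h).1 * ((σ.hom g).1 * X * (ρ.hom g⁻¹).1))]
  refine Finset.sum_congr rfl fun g _ => ?_
  have h1 : (σ.hom h).1 * (σ.hom (h⁻¹ * g)).1 = (σ.hom g).1 := by
    rw [← Submonoid.coe_mul, ← map_mul, mul_inv_cancel_left]
  have h2 : (ρ.hom (h⁻¹ * g)⁻¹).1 = (ρ.hom g⁻¹).1 * (ρ.hom h).1 := by
    rw [← Submonoid.coe_mul, ← map_mul, mul_inv_rev, inv_inv]
  simp only [Equiv.coe_mulLeft, h2, ← Matrix.mul_assoc, h1]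

theorem sum_conj_eq_zero {ρ σ : UnitaryIrrep G} (h : ¬ ρ ≈ σ)
    (X : Matrix (Fin σ.dim) (Fin ρ.dim) ℂ) :
    ∑ g, (σ.hom g).1 * X * (ρ.hom g⁻¹).1 = 0 :=
  intertwining_eq_zero h _ (sum_conj_intertwining ρ σ X)

theorem sum_conj_eq_smul_one (ρ : UnitaryIrrep G) (X : Matrix (Fin ρ.dim) (Fin ρ.dim) ℂ) :
    ∑ g, (ρ.hom g).1 * X * (ρ.hom g⁻¹).1 =
      ((Fintype.card G : ℂ) / ρ.dim * X.trace) • 1 := by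
  obtain ⟨c, hc⟩ := intertwining_eq_smul_one ρ _ (sum_conj_intertwining ρ ρ X)
  have hd : (ρ.dim : ℂ) ≠ 0 := by exact_mod_cast ρ.dim_pos.ne'
  -- The trace identifies the scalar: conjugation preserves it, so `|G| Tr X = c d_ρ`.
  have h1 := congrArg Matrix.trace hc
  rw [Matrix.trace_sum, Matrix.trace_smul, Matrix.trace_one, Fintype.card_fin] at h1
  have h2 : ∀ g, ((ρ.hom g).1 * X * (ρ.hom g⁻¹).1).trace = X.trace := fun g => by
    rw [Matrix.trace_mul_cycle, ← Submonoid.coe_mul, ← map_mul, inv_mul_cancel, map_one,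
      Submonoid.coe_one, Matrix.one_mul]
  simp only [h2, Finset.sum_const, Finset.card_univ, nsmul_eq_mul, smul_eq_mul] at h1
  rw [hc]
  congr 1
  field_simp
  exact h1.symm

/-- Schur orthogonality for the matrix coefficients of inequivalent irreps. -/
theorem sum_coeff_mul_coeff_eq_zero {ρ σ : UnitaryIrrep G} (h : ¬ ρ ≈ σ)
    (k l : Fin σ.dim) (j i : Fin ρ.dim) :
    ∑ g, (σ.hom g).1 k l * (ρ.hom g⁻¹).1 j i = 0 := by
  -- Averaging the matrix unit at `(l, j)` and reading off the entry `(k, i)` isolates one product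
  -- of coefficients.
  have h1 := congrFun (congrFun (sum_conj_eq_zero h (Matrix.single l j 1)) k) i
  simpa [-map_inv, Matrix.sum_apply, Matrix.mul_apply, Matrix.single_apply, ite_and] using h1

/-- Schur orthogonality for the matrix coefficients of an irrep. -/
theorem sum_coeff_mul_coeff (ρ : UnitaryIrrep G) (k l j i : Fin ρ.dim) :
    ∑ g, (ρ.hom g).1 k l * (ρ.hom g⁻¹).1 j i =
      if k = i ∧ l = j then (Fintype.card G : ℂ) / ρ.dim else 0 := by
  have h1 := congrFun (congrFun (sum_conj_eq_smul_one ρ (Matrix.single l j 1)) k) i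
  have h2 : (Matrix.single l j (1 : ℂ)).trace = if l = j then 1 else 0 := by
    split_ifs with h
    · subst h; simp
    · exact Matrix.trace_single_eq_of_ne _ _ _ h
  rw [h2] at h1
  simp [-map_inv, Matrix.sum_apply, Matrix.mul_apply, Matrix.single_apply, ite_and,
    Matrix.one_apply] at h1
  rw [h1, ite_and]

theorem UnitaryIrrep.toAlgHom_embed_apply (ρ σ : UnitaryIrrep G)
    (a : Matrix (Fin ρ.dim) (Fin ρ.dim) ℂ) (k l : Fin σ.dim) :
    σ.toAlgHom (ρ.embed a) k l = (ρ.dim : ℂ) / (Fintype.card G : ℂ) *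
      ∑ i, ∑ j, a i j * ∑ g, (σ.hom g).1 k l * (ρ.hom g⁻¹).1 j i := by
  have h : ρ.embed a = ((ρ.dim : ℂ) / (Fintype.card G : ℂ)) •
    ∑ g : G, MonoidAlgebra.single g (∑ i, ∑ j, (ρ.hom g⁻¹).1 j i * a i j) := rfl
  rw [h, map_smul, map_sum, Matrix.smul_apply, Matrix.sum_apply, smul_eq_mul]
  simp only [UnitaryIrrep.toAlgHom_single, Matrix.smul_apply, smul_eq_mul, Finset.mul_sum,
    Finset.sum_mul]
  rw [Finset.sum_comm]
  refine Finset.sum_congr rfl fun i _ => ?_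
  rw [Finset.sum_comm]
  exact Finset.sum_congr rfl fun j _ => Finset.sum_congr rfl fun g _ => by ring

theorem UnitaryIrrep.toAlgHom_embed_of_not_equiv {ρ σ : UnitaryIrrep G} (h : ¬ ρ ≈ σ)
    (a : Matrix (Fin ρ.dim) (Fin ρ.dim) ℂ) : σ.toAlgHom (ρ.embed a) = 0 := by
  ext k l
  simp [-map_inv, UnitaryIrrep.toAlgHom_embed_apply, sum_coeff_mul_coeff_eq_zero h]

theorem UnitaryIrrep.toAlgHom_embed (ρ : UnitaryIrrep G)
    (a : Matrix (Fin ρ.dim) (Fin ρ.dim) ℂ) : ρ.toAlgHom (ρ.embed a) = a := by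
  have hd : (ρ.dim : ℂ) ≠ 0 := by exact_mod_cast ρ.dim_pos.ne'
  have hG : (Fintype.card G : ℂ) ≠ 0 := by exact_mod_cast Fintype.card_ne_zero
  ext k l
  rw [UnitaryIrrep.toAlgHom_embed_apply]
  simp only [sum_coeff_mul_coeff, ite_and, mul_ite, mul_zero, Finset.sum_ite_eq,
    Finset.sum_ite_irrel, Finset.sum_const_zero, Finset.mem_univ, if_true]
  field_simp

/-- In the trace form of the coefficients, translations of `G` can be absorbed by multiplicativity
of `ρ` and cyclicity of the trace. -/
theorem UnitaryIrrep.embed_eq_sum_trace (ρ : UnitaryIrrep G)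
    (a : Matrix (Fin ρ.dim) (Fin ρ.dim) ℂ) :
    ρ.embed a = ((ρ.dim : ℂ) / (Fintype.card G : ℂ)) •
      ∑ g : G, MonoidAlgebra.single g ((ρ.hom g⁻¹).1 * a).trace := by
  have h : ∀ g : G, ((ρ.hom g⁻¹).1 * a).trace = ∑ i, ∑ j, (ρ.hom g⁻¹).1 j i * a i j :=
    fun g => by
      simp only [Matrix.trace, Matrix.diag_apply, Matrix.mul_apply]
      exact Finset.sum_comm
  simp only [h]
  rfl

theorem UnitaryIrrep.embed_one (ρ : UnitaryIrrep G) : ρ.embed 1 = ρ.proj := by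
  rw [UnitaryIrrep.embed_eq_sum_trace]
  simp only [Matrix.mul_one]
  rfl

/-- No orthogonality is needed: for `x = h`, the substitution `g ↦ hg` turns the coefficient
`Tr(ρ(g⁻¹) ρ(h))` into `Tr(ρ(g⁻¹))`. -/
theorem UnitaryIrrep.embed_toAlgHom (ρ : UnitaryIrrep G) (x : MonoidAlgebra ℂ G) :
    ρ.embed (ρ.toAlgHom x) = x * ρ.proj := by
  induction x using MonoidAlgebra.induction_linear with
  | zero => simp
  | add x y hx hy => simp only [map_add, add_mul, hx, hy]
  | single h a =>
    rw [← ρ.embed_one, ρ.embed_eq_sum_trace, ρ.embed_eq_sum_trace, mul_smul_comm, Finset.mul_sum,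
      ← Equiv.sum_comp (Equiv.mulLeft h)]
    congr 1
    refine Finset.sum_congr rfl fun g _ => ?_
    rw [Equiv.coe_mulLeft, MonoidAlgebra.single_mul_single, UnitaryIrrep.toAlgHom_single,
      Matrix.mul_smul, Matrix.trace_smul, ← Submonoid.coe_mul, ← map_mul, mul_inv_rev,
      inv_mul_cancel_right, Matrix.mul_one, smul_eq_mul]

/-- The same with `g ↦ gh` and cyclicity of the trace. Comparison with `UnitaryIrrep.embed_toAlgHom`
gives centrality of `proj`. -/
theorem UnitaryIrrep.embed_toAlgHom' (ρ : UnitaryIrrep G) (x : MonoidAlgebra ℂ G) :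
    ρ.embed (ρ.toAlgHom x) = ρ.proj * x := by
  induction x using MonoidAlgebra.induction_linear with
  | zero => simp
  | add x y hx hy => simp only [map_add, mul_add, hx, hy]
  | single h a =>
    rw [← ρ.embed_one, ρ.embed_eq_sum_trace, ρ.embed_eq_sum_trace, smul_mul_assoc, Finset.sum_mul,
      ← Equiv.sum_comp (Equiv.mulRight h)]
    congr 1
    refine Finset.sum_congr rfl fun g _ => ?_
    rw [Equiv.coe_mulRight, MonoidAlgebra.single_mul_single, UnitaryIrrep.toAlgHom_single,
      Matrix.mul_smul, Matrix.trace_smul, Matrix.trace_mul_comm, ← Submonoid.coe_mul, ← map_mul,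
      mul_inv_rev, mul_inv_cancel_left, Matrix.mul_one, smul_eq_mul, mul_comm]

theorem UnitaryIrrep.proj_mul_comm (ρ : UnitaryIrrep G) (x : MonoidAlgebra ℂ G) :
    ρ.proj * x = x * ρ.proj := by
  rw [← ρ.embed_toAlgHom, ← ρ.embed_toAlgHom']

theorem UnitaryIrrep.toAlgHom_proj (ρ : UnitaryIrrep G) : ρ.toAlgHom ρ.proj = 1 := by
  rw [← ρ.embed_one, ρ.toAlgHom_embed]

theorem UnitaryIrrep.toAlgHom_proj_of_not_equiv {ρ σ : UnitaryIrrep G} (h : ¬ ρ ≈ σ) :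
    σ.toAlgHom ρ.proj = 0 := by
  rw [← ρ.embed_one, UnitaryIrrep.toAlgHom_embed_of_not_equiv h]

theorem UnitaryIrrep.proj_mul_self (ρ : UnitaryIrrep G) : ρ.proj * ρ.proj = ρ.proj := by
  rw [← ρ.embed_toAlgHom, ρ.toAlgHom_proj, ρ.embed_one]

theorem UnitaryIrrep.proj_mul_proj {ρ σ : UnitaryIrrep G} (h : ¬ ρ ≈ σ) :
    ρ.proj * σ.proj = 0 := by
  rw [← σ.embed_toAlgHom, UnitaryIrrep.toAlgHom_proj_of_not_equiv h, map_zero]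

theorem UnitaryIrrep.toAlgHom_star (ρ : UnitaryIrrep G) (x : MonoidAlgebra ℂ G) :
    ρ.toAlgHom (star x) = star (ρ.toAlgHom x) := by
  induction x using MonoidAlgebra.induction_linear with
  | zero => simp
  | add x y hx hy => simp only [map_add, star_add, hx, hy]
  | single g a =>
    rw [star_single, UnitaryIrrep.toAlgHom_single, UnitaryIrrep.toAlgHom_single, star_smul,
      val_inv_eq_star]

/-- Unitarity enters here: after `g ↦ g⁻¹`, the conjugate of `Tr(ρ(g) a)` is `Tr(ρ(g⁻¹) a*)`. -/
theorem UnitaryIrrep.star_embed (ρ : UnitaryIrrep G)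
    (a : Matrix (Fin ρ.dim) (Fin ρ.dim) ℂ) : star (ρ.embed a) = ρ.embed (star a) := by
  rw [ρ.embed_eq_sum_trace, ρ.embed_eq_sum_trace, star_smul, star_sum,
    ← Equiv.sum_comp (Equiv.inv G)]
  congr 1
  · simp
  · refine Finset.sum_congr rfl fun g _ => ?_
    rw [Equiv.inv_apply, star_single, inv_inv, ← Matrix.trace_conjTranspose,
      Matrix.conjTranspose_mul, Matrix.trace_mul_comm, val_inv_eq_star]
    rfl

theorem UnitaryIrrep.star_proj (ρ : UnitaryIrrep G) : star ρ.proj = ρ.proj := by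
  rw [← ρ.embed_one, ρ.star_embed, star_one]

/-- Only the dimension and the character enter `proj`, and both are invariants of the class. In
general `embed` does depend on the representative. -/
theorem UnitaryIrrep.proj_eq_of_equiv {ρ σ : UnitaryIrrep G} (h : ρ ≈ σ) : ρ.proj = σ.proj := by
  obtain ⟨e⟩ := h
  have hd : ρ.dim = σ.dim := by simpa using e.toLinearEquiv.finrank_eq
  have ht : ∀ g, (ρ.hom g).1.trace = (σ.hom g).1.trace := fun g => by
    have h1 := congrFun (Representation.char_iso e) g
    have h2 : ∀ τ : UnitaryIrrep G, (unitaryRep τ.hom).character g = (τ.hom g).1.trace := fun τ =>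
      Matrix.trace_toLin'_eq (τ.hom g).1
    rwa [h2, h2] at h1
  simp only [UnitaryIrrep.proj, hd, ht]

end SchurOrthogonality

/-! ### Unitarization, and separation of `ℂG` by its unitary irreps -/

section Unitarization

variable {G : Type*} [Group G]

open scoped ComplexOrder MatrixOrder in
/-- Averaging the standard inner product: a matrix representation of a finite group is conjugate to
a unitary one. -/
theorem exists_isUnit_conj_mem_unitary [Fintype G] {d : ℕ} (f : G →* Matrix (Fin d) (Fin d) ℂ) :
    ∃ Q : (Matrix (Fin d) (Fin d) ℂ)ˣ, ∀ g, Q.1 * f g * Q⁻¹.1 ∈ Matrix.unitaryGroup (Fin d) ℂ := by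
  classical
  have hP : (∑ g, star (f g) * f g).PosDef := by
    -- The summand of `g = 1` is the identity matrix, which makes the positive semidefinite sum
    -- definite.
    rw [← Finset.add_sum_erase _ _ (Finset.mem_univ (1 : G)), map_one, star_one, one_mul]
    exact Matrix.PosDef.one.add_posSemidef
      (Matrix.posSemidef_sum _ fun g _ => Matrix.posSemidef_conjTranspose_mul_self (f g))
  obtain ⟨q, hq⟩ := CStarAlgebra.nonneg_iff_eq_star_mul_self.mp hP.posSemidef.nonneg
  have hqu : IsUnit q := isUnit_of_mul_isUnit_right (hq ▸ hP.isUnit)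
  obtain ⟨Q, rfl⟩ := hqu
  refine ⟨Q, fun h => Matrix.mem_unitaryGroup_iff'.2 ?_⟩
  -- The averaged form is `G`-invariant. Since it equals `Q* Q`, this is unitarity of `Q f(h) Q⁻¹`.
  have hinv : star (f h) * (star Q.1 * Q.1) * f h = star Q.1 * Q.1 := by
    rw [← hq, Finset.mul_sum, Finset.sum_mul]
    refine Eq.trans (Finset.sum_congr rfl fun g _ => ?_)
      (Equiv.sum_comp (Equiv.mulRight h) fun g => star (f g) * f g)
    rw [Equiv.coe_mulRight, map_mul, star_mul]
    simp only [mul_assoc]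
  have h1 : star Q⁻¹.1 * star Q.1 = 1 := by rw [← star_mul, Units.mul_inv, star_one]
  calc star (Q.1 * f h * Q⁻¹.1) * (Q.1 * f h * Q⁻¹.1)
      = star Q⁻¹.1 * (star (f h) * (star Q.1 * Q.1) * f h) * Q⁻¹.1 := by
        simp only [star_mul, mul_assoc]
    _ = star Q⁻¹.1 * star Q.1 * (Q.1 * Q⁻¹.1) := by rw [hinv]; simp only [mul_assoc]
    _ = 1 := by rw [h1, Units.mul_inv, mul_one]

/-- Irreducibility is invariant under equivalence. -/
theorem isIrreducible_of_equiv {V W : Type*} [AddCommGroup V] [Module ℂ V] [AddCommGroup W]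
    [Module ℂ W] {τ : Representation ℂ G V} {σ : Representation ℂ G W} (e : τ.Equiv σ)
    [h : τ.IsIrreducible] : σ.IsIrreducible := by
  let c : Subrepresentation σ ≃o Subrepresentation τ :=
    { toFun := fun S => ⟨S.toSubmodule.comap e.toLinearMap, fun g v hv => by
        change e (τ g v) ∈ S.toSubmodule
        rw [show e (τ g v) = σ g (e v) from
          Representation.IntertwiningMap.isIntertwining τ σ e.toIntertwiningMap g v]
        exact S.apply_mem_toSubmodule g hv⟩
      invFun := fun S => ⟨S.toSubmodule.comap e.symm.toLinearMap, fun g v hv => by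
        change e.symm (σ g v) ∈ S.toSubmodule
        rw [show e.symm (σ g v) = τ g (e.symm v) from
          Representation.IntertwiningMap.isIntertwining σ τ e.symm.toIntertwiningMap g v]
        exact S.apply_mem_toSubmodule g hv⟩
      left_inv := fun S => Subrepresentation.toSubmodule_injective <| Submodule.ext fun v => by
        change e (e.symm v) ∈ S.toSubmodule ↔ _
        rw [e.apply_symm_apply]
      right_inv := fun S => Subrepresentation.toSubmodule_injective <| Submodule.ext fun v => by
        change e.symm (e v) ∈ S.toSubmodule ↔ _
        rw [e.symm_apply_apply]
      map_rel_iff' := fun {S T} => by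
        refine ⟨fun hST v hv => ?_, fun hST v hv => hST hv⟩
        have h1 : e (e.symm v) ∈ T.toSubmodule :=
          hST (show e (e.symm v) ∈ S.toSubmodule by rwa [e.apply_symm_apply])
        rwa [e.apply_symm_apply] at h1 }
  exact (OrderIso.isSimpleOrder_iff c).2 h

/-- Every finite dimensional irreducible representation of a finite group is equivalent to a
unitary one. -/
theorem exists_unitaryIrrep_equiv [Fintype G] {V : Type*} [AddCommGroup V] [Module ℂ V]
    [FiniteDimensional ℂ V] (τ : Representation ℂ G V) [τ.IsIrreducible] :
    ∃ ρ : UnitaryIrrep G, Nonempty (τ.Equiv (unitaryRep ρ.hom)) := by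
  let b := Module.finBasis ℂ V
  let M := LinearMap.toMatrixAlgEquiv b
  obtain ⟨Q, hQ⟩ := exists_isUnit_conj_mem_unitary (M.toAlgHom.toMonoidHom.comp τ)
  let f : G →* Matrix.unitaryGroup (Fin (Module.finrank ℂ V)) ℂ :=
    { toFun := fun g => ⟨_, hQ g⟩
      map_one' := Subtype.ext (by simp)
      map_mul' := fun g h => Subtype.ext (by simp [mul_assoc]) }
  -- The equivalence takes coordinates in the basis `b` and then applies `Q`.
  let e : τ.Equiv (unitaryRep f) := Representation.Equiv.mk
    (b.equivFun.trans (Matrix.toLin'OfInv (Units.inv_mul Q) (Units.mul_inv Q))) fun g => by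
      refine LinearMap.ext fun v => ?_
      have h1 : ∀ w, Matrix.toLin'OfInv (Units.inv_mul Q) (Units.mul_inv Q) w = Q.1.mulVec w :=
        fun w => Matrix.toLin'_apply _ _
      rw [LinearMap.comp_apply, LinearMap.comp_apply, LinearEquiv.coe_coe, LinearEquiv.trans_apply,
        LinearEquiv.trans_apply, h1, h1, unitaryRep_apply]
      change Q.1.mulVec (b.equivFun (τ g v)) =
        (Q.1 * M (τ g) * Q⁻¹.1).mulVec (Q.1.mulVec (b.equivFun v))
      rw [Matrix.mulVec_mulVec, mul_assoc, mul_assoc, Units.inv_mul, mul_one,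
        ← Matrix.mulVec_mulVec]
      congr 1
      exact (LinearMap.toMatrix_mulVec_repr b b (τ g) v).symm
  exact ⟨⟨_, f, isIrreducible_of_equiv e⟩, ⟨e⟩⟩

theorem UnitaryIrrep.asAlgebraHom_unitaryRep (ρ : UnitaryIrrep G) (x : MonoidAlgebra ℂ G)
    (v : Fin ρ.dim → ℂ) : (unitaryRep ρ.hom).asAlgebraHom x v = (ρ.toAlgHom x).mulVec v := by
  induction x using MonoidAlgebra.induction_linear with
  | zero => simp
  | add x y hx hy => rw [map_add, map_add, LinearMap.add_apply, hx, hy, Matrix.add_mulVec]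
  | single g a =>
    rw [Representation.asAlgebraHom_single, UnitaryIrrep.toAlgHom_single, Matrix.smul_mulVec]
    rfl

theorem equiv_asAlgebraHom_apply {V W : Type*} [AddCommGroup V] [Module ℂ V] [AddCommGroup W]
    [Module ℂ W] {τ : Representation ℂ G V} {σ : Representation ℂ G W} (e : τ.Equiv σ)
    (x : MonoidAlgebra ℂ G) (v : V) : e (τ.asAlgebraHom x v) = σ.asAlgebraHom x (e v) := by
  induction x using MonoidAlgebra.induction_linear with
  | zero => simp
  | add x y hx hy => simp only [map_add, LinearMap.add_apply, hx, hy]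
  | single g a =>
    simp only [Representation.asAlgebraHom_single, LinearMap.smul_apply, map_smul]
    congr 1
    exact Representation.IntertwiningMap.isIntertwining τ σ e.toIntertwiningMap g v

section Simple

variable {S : Type*} [AddCommGroup S] [Module ℂ S] [Module (MonoidAlgebra ℂ G) S]
  [IsScalarTower ℂ (MonoidAlgebra ℂ G) S]

theorem asAlgebraHom_ofModule' (x : MonoidAlgebra ℂ G) (s : S) :
    (Representation.ofModule' (k := ℂ) (G := G) S).asAlgebraHom x s = x • s := by
  have h : (Representation.ofModule' (k := ℂ) (G := G) S).asAlgebraHom =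
    Algebra.lsmul ℂ ℂ S := (MonoidAlgebra.lift ℂ (S →ₗ[ℂ] S) G).apply_symm_apply _
  rw [h]
  rfl

/-- A complex subspace is stable under `G` exactly when it is a `ℂG`-submodule, so the two lattices
coincide. -/
theorem isIrreducible_ofModule' [h : IsSimpleModule (MonoidAlgebra ℂ G) S] :
    (Representation.ofModule' (k := ℂ) (G := G) S).IsIrreducible := by
  have hs : ∀ (g : G) (s : S), Representation.ofModule' (k := ℂ) (G := G) S g s =
    MonoidAlgebra.single g (1 : ℂ) • s := fun _ _ => rfl
  let c : Subrepresentation (Representation.ofModule' (k := ℂ) (G := G) S) ≃o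
      Submodule (MonoidAlgebra ℂ G) S :=
    { toFun := fun W =>
        { W.toSubmodule with
          smul_mem' := fun x s (hx : s ∈ W.toSubmodule) => by
            change x • s ∈ W.toSubmodule
            induction x using MonoidAlgebra.induction_linear with
            | zero => rw [zero_smul]; exact zero_mem _
            | add x y hx hy => rw [add_smul]; exact add_mem hx hy
            | single g a =>
              have h1 : MonoidAlgebra.single g a = a • MonoidAlgebra.single g (1 : ℂ) := by
                rw [MonoidAlgebra.smul_single, smul_eq_mul, mul_one]
              rw [h1, smul_assoc, ← hs]
              exact W.toSubmodule.smul_mem a (W.apply_mem_toSubmodule g hx) }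
      invFun := fun N => ⟨N.restrictScalars ℂ, fun g s hx => by
        rw [hs]
        exact N.smul_mem _ hx⟩
      left_inv := fun _ => rfl
      right_inv := fun _ => rfl
      map_rel_iff' := Iff.rfl }
  exact (OrderIso.isSimpleOrder_iff c).2 ((isSimpleModule_iff _ _).1 h)

/-- An element of `ℂG` that vanishes in all irreducible unitary representations annihilates all
simple modules. -/
theorem smul_eq_zero_of_toAlgHom_eq_zero [Fintype G] {x : MonoidAlgebra ℂ G}
    (hx : ∀ ρ : UnitaryIrrep G, ρ.toAlgHom x = 0) [IsSimpleModule (MonoidAlgebra ℂ G) S] (s : S) :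
    x • s = 0 := by
  -- A simple module is finitely generated over `ℂG`, which is finite dimensional; so the module can
  -- be unitarized.
  have : FiniteDimensional ℂ S := Module.Finite.trans (MonoidAlgebra ℂ G) S
  have := isIrreducible_ofModule' (G := G) (S := S)
  obtain ⟨ρ, ⟨e⟩⟩ := exists_unitaryIrrep_equiv (Representation.ofModule' (k := ℂ) (G := G) S)
  have h1 := equiv_asAlgebraHom_apply e x s
  rw [UnitaryIrrep.asAlgebraHom_unitaryRep, hx, Matrix.zero_mulVec, asAlgebraHom_ofModule'] at h1
  exact e.toLinearEquiv.map_eq_zero_iff.1 h1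

end Simple

/-- The irreducible unitary representations separate the elements of `ℂG`. -/
theorem eq_zero_of_toAlgHom_eq_zero [Fintype G] {x : MonoidAlgebra ℂ G}
    (hx : ∀ ρ : UnitaryIrrep G, ρ.toAlgHom x = 0) : x = 0 := by
  -- By semisimplicity, 1 lies in the sum of the simple left ideals. Each of them is annihilated by
  -- `x`, so `x * 1 = 0`.
  have h1 := IsSemisimpleModule.sSup_simples_eq_top (MonoidAlgebra ℂ G) (MonoidAlgebra ℂ G)
  have h2 : ∀ y ∈ sSup {m : Submodule (MonoidAlgebra ℂ G) (MonoidAlgebra ℂ G) |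
      IsSimpleModule (MonoidAlgebra ℂ G) m}, x * y = 0 := by
    intro y hy
    rw [sSup_eq_iSup'] at hy
    refine Submodule.iSup_induction _ (motive := fun y => x * y = 0) hy ?_ (mul_zero x)
      fun y z hy hz => by rw [mul_add, hy, hz, add_zero]
    rintro ⟨m, hm⟩ y hy
    have : IsSimpleModule (MonoidAlgebra ℂ G) m := hm
    exact congrArg Subtype.val (smul_eq_zero_of_toAlgHom_eq_zero hx (⟨y, hy⟩ : m))
  simpa using h2 1 (h1 ▸ Submodule.mem_top)

end Unitarization

/-! ### Finiteness of the dual, completeness, and the role of the counit -/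

section Completeness

variable {G : Type*} [Group G]
variable {r : UnitaryDual G → UnitaryIrrep G}

/-- The choice `r` picks an irrep in every class. -/
def IsSection (r : UnitaryDual G → UnitaryIrrep G) : Prop :=
  ∀ c : UnitaryDual G, (Quotient.mk (unitaryIrrepSetoid G) (r c) : UnitaryDual G) = c

theorem not_equiv_of_ne (hr : IsSection r) {c c' : UnitaryDual G} (h : c ≠ c') :
    ¬ r c ≈ r c' := fun e => h ((hr c).symm.trans ((Quotient.sound e).trans (hr c')))

theorem exists_equiv (hr : IsSection r) (ρ : UnitaryIrrep G) :
    r (Quotient.mk (unitaryIrrepSetoid G) ρ) ≈ ρ := Quotient.exact (hr _)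

/-- Applying the irrep of class `c` to a linear relation leaves the coefficient of `c` times the
identity matrix. -/
theorem linearIndependent_proj [Fintype G] (hr : IsSection r) :
    LinearIndependent ℂ fun c => (r c).proj := by
  rw [linearIndependent_iff']
  intro s a hs c hc
  have h1 := congrArg (r c).toAlgHom hs
  rw [map_sum, map_zero, Finset.sum_eq_single c, map_smul, UnitaryIrrep.toAlgHom_proj] at h1
  · have h2 := congrFun (congrFun h1 ⟨0, (r c).dim_pos⟩) ⟨0, (r c).dim_pos⟩
    simpa using h2
  · intro c' _ hne
    rw [map_smul, UnitaryIrrep.toAlgHom_proj_of_not_equiv (not_equiv_of_ne hr hne), smul_zero]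
  · exact fun h => absurd hc h

theorem finite_unitaryDual [Fintype G] (hr : IsSection r) : Finite (UnitaryDual G) := by
  have : Module.Finite ℂ (MonoidAlgebra ℂ G) := inferInstance
  exact (linearIndependent_proj hr).finite

theorem sum_proj_eq_one [Fintype G] [Fintype (UnitaryDual G)] (hr : IsSection r) :
    ∑ c, (r c).proj = 1 := by
  rw [eq_comm, ← sub_eq_zero]
  refine eq_zero_of_toAlgHom_eq_zero fun ρ => ?_
  let c : UnitaryDual G := Quotient.mk (unitaryIrrepSetoid G) ρ
  -- Separation ranges over all irreps `ρ`, not only the chosen ones, so the projection of the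
  -- representative is replaced by that of `ρ`.
  rw [map_sub, map_one, map_sum, Finset.sum_eq_single c, UnitaryIrrep.proj_eq_of_equiv
    (exists_equiv hr ρ), UnitaryIrrep.toAlgHom_proj, sub_self]
  · intro c' _ hne
    exact UnitaryIrrep.toAlgHom_proj_of_not_equiv fun e => hne ((hr c').symm.trans (Quotient.sound e))
  · exact fun h => absurd (Finset.mem_univ c) h

theorem trivialIrrep_toAlgHom (x : MonoidAlgebra ℂ G) :
    (trivialIrrep G).toAlgHom x = Bialgebra.counitAlgHom ℂ (MonoidAlgebra ℂ G) x • 1 := by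
  induction x using MonoidAlgebra.induction_linear with
  | zero => simp
  | add x y hx hy => rw [map_add, map_add, hx, hy, add_smul]
  | single g a =>
    rw [UnitaryIrrep.toAlgHom_single]
    simp only [trivialIrrep, Bialgebra.counitAlgHom_apply, MonoidAlgebra.counit_single,
      CommSemiring.counit_apply]
    rfl

/-- The chosen representative of the trivial class need not be `trivialIrrep` itself, but its
projection is the same. -/
theorem proj_trivialClass [Fintype G] (hr : IsSection r) :
    (r (trivialClass G)).proj = (trivialIrrep G).proj :=
  UnitaryIrrep.proj_eq_of_equiv (exists_equiv hr (trivialIrrep G))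

theorem counit_smul_one_eq_zero {z : ℂ}
    (h : z • (1 : Matrix (Fin (trivialIrrep G).dim) (Fin (trivialIrrep G).dim) ℂ) = 0) : z = 0 := by
  have h1 := congrFun (congrFun h ⟨0, (trivialIrrep G).dim_pos⟩) ⟨0, (trivialIrrep G).dim_pos⟩
  simpa using h1

theorem counit_proj_trivialClass [Fintype G] (hr : IsSection r) :
    Bialgebra.counitAlgHom ℂ (MonoidAlgebra ℂ G) (r (trivialClass G)).proj = 1 := by
  rw [proj_trivialClass hr, ← sub_eq_zero]
  refine counit_smul_one_eq_zero (G := G) ?_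
  rw [sub_smul, ← trivialIrrep_toAlgHom, UnitaryIrrep.toAlgHom_proj, one_smul, sub_self]

/-- The counit is the trivial representation, so orthogonality to the trivial class places the
blocks of nontrivial classes inside `ℂG⁺`. -/
theorem counit_embed [Fintype G] (hr : IsSection r) (c : NontrivialDual G)
    (a : Matrix (Fin (r c).dim) (Fin (r c).dim) ℂ) :
    Bialgebra.counitAlgHom ℂ (MonoidAlgebra ℂ G) ((r c).embed a) = 0 := by
  refine counit_smul_one_eq_zero (G := G) ?_
  rw [← trivialIrrep_toAlgHom]
  exact UnitaryIrrep.toAlgHom_embed_of_not_equiv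
    (fun e => c.2 ((hr c).symm.trans (Quotient.sound e))) a

theorem counit_proj [Fintype G] (hr : IsSection r) (c : NontrivialDual G) :
    Bialgebra.counitAlgHom ℂ (MonoidAlgebra ℂ G) (r c).proj = 0 := by
  rw [← UnitaryIrrep.embed_one, counit_embed hr]

theorem mul_proj_trivialClass [Fintype G] (hr : IsSection r) (x : MonoidAlgebra ℂ G) :
    x * (r (trivialClass G)).proj =
      Bialgebra.counitAlgHom ℂ (MonoidAlgebra ℂ G) x • (r (trivialClass G)).proj := by
  rw [proj_trivialClass hr, ← UnitaryIrrep.embed_toAlgHom, trivialIrrep_toAlgHom, map_smul,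
    UnitaryIrrep.embed_one]

end Completeness

/-! ### Functoriality of forms in the coefficient algebra -/

section MapForms

variable {H K : Type*} [Ring H] [Algebra ℂ H] [Ring K] [Algebra ℂ K]
variable {A : Type*} [Ring A] [Algebra ℂ A] {Ω : ℕ → Submodule ℂ A}

theorem map_mem_valForms {L : Submodule ℂ H} {M : Submodule ℂ K} (f : H →ₗ[ℂ] K)
    (hf : ∀ a ∈ L, f a ∈ M) {n : ℕ} {x : H ⊗[ℂ] A} (hx : x ∈ valForms Ω L n) :
    TensorProduct.map f LinearMap.id x ∈ valForms Ω M n :=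
  valForms_induction (p := fun x => TensorProduct.map f LinearMap.id x ∈ valForms Ω M n)
    (by simp) (fun a ha _ hω => tmul_mem_valForms (hf a ha) hω)
    (fun x y hx hy => by rw [map_add]; exact add_mem hx hy) hx

variable [GradedAlgebra Ω] (D : StarDGA Ω)

theorem map_extD (f : H →ₗ[ℂ] K) (x : H ⊗[ℂ] A) :
    TensorProduct.map f LinearMap.id (extD H D x) =
      extD K D (TensorProduct.map f LinearMap.id x) := by
  induction x using TensorProduct.induction_on with
  | zero => simp
  | tmul a ω => rfl
  | add x y hx hy => simp only [map_add, hx, hy]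

theorem conj_one : D.conj 1 = 1 := by
  have h := D.conj_mul 0 0 1 (D.conj 1) SetLike.GradedOne.one_mem
    (D.conj_mem 0 1 SetLike.GradedOne.one_mem)
  rw [one_mul, D.conj_conj] at h
  simpa using h.symm

variable [StarRing H] [StarModule ℂ H] [StarRing K] [StarModule ℂ K]

theorem map_tstar (f : H →ₗ[ℂ] K) (hf : ∀ a, f (star a) = star (f a)) (x : H ⊗[ℂ] A) :
    TensorProduct.map f LinearMap.id (tstar H D x) =
      tstar K D (TensorProduct.map f LinearMap.id x) := by
  induction x using TensorProduct.induction_on with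
  | zero => simp
  | tmul a ω =>
    rw [tstar_tmul, TensorProduct.map_tmul, TensorProduct.map_tmul, tstar_tmul, hf]
    rfl
  | add x y hx hy => simp only [map_add, hx, hy]

/-- Linearity and compatibility with `*` suffice, so this serves both `toAlgHom` and the non-unital
`embed`. -/
theorem map_mem_antiHermForms {L : Submodule ℂ H} {M : Submodule ℂ K} (f : H →ₗ[ℂ] K)
    (hf : ∀ a ∈ L, f a ∈ M) (hs : ∀ a, f (star a) = star (f a)) {n : ℕ} {x : H ⊗[ℂ] A}
    (hx : x ∈ antiHermForms D L n) :
    TensorProduct.map f LinearMap.id x ∈ antiHermForms D M n := by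
  rw [mem_antiHermForms] at hx ⊢
  refine ⟨map_mem_valForms f hf hx.1, ?_⟩
  rw [← map_tstar D f hs, hx.2, map_neg]

end MapForms

/-! ### Block decomposition of `ℂG ⊗ A` -/

section Blocks

variable {G : Type*} [Group G] {A : Type*} [Ring A] [Algebra ℂ A]

theorem UnitaryIrrep.block_apply (ρ : UnitaryIrrep G) (x : MonoidAlgebra ℂ G ⊗[ℂ] A) :
    ρ.block A x = TensorProduct.map ρ.toAlgHom.toLinearMap LinearMap.id x := rfl

variable [Fintype G]

theorem UnitaryIrrep.embedBlock_apply (ρ : UnitaryIrrep G)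
    (x : Matrix (Fin ρ.dim) (Fin ρ.dim) ℂ ⊗[ℂ] A) :
    ρ.embedBlock A x = TensorProduct.map ρ.embed LinearMap.id x := rfl

theorem UnitaryIrrep.block_embedBlock (ρ : UnitaryIrrep G)
    (x : Matrix (Fin ρ.dim) (Fin ρ.dim) ℂ ⊗[ℂ] A) : ρ.block A (ρ.embedBlock A x) = x := by
  induction x using TensorProduct.induction_on with
  | zero => simp
  | tmul a ω =>
    rw [ρ.embedBlock_apply, ρ.block_apply, TensorProduct.map_tmul, TensorProduct.map_tmul,
      AlgHom.toLinearMap_apply, ρ.toAlgHom_embed]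
    rfl
  | add x y hx hy => simp only [map_add, hx, hy]

theorem UnitaryIrrep.block_embedBlock_of_not_equiv {ρ σ : UnitaryIrrep G} (h : ¬ ρ ≈ σ)
    (x : Matrix (Fin ρ.dim) (Fin ρ.dim) ℂ ⊗[ℂ] A) : σ.block A (ρ.embedBlock A x) = 0 := by
  induction x using TensorProduct.induction_on with
  | zero => simp
  | tmul a ω =>
    rw [ρ.embedBlock_apply, σ.block_apply, TensorProduct.map_tmul, TensorProduct.map_tmul,
      AlgHom.toLinearMap_apply, UnitaryIrrep.toAlgHom_embed_of_not_equiv h,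
      TensorProduct.zero_tmul]
  | add x y hx hy => simp only [map_add, hx, hy, add_zero]

theorem UnitaryIrrep.embedBlock_block (ρ : UnitaryIrrep G) (x : MonoidAlgebra ℂ G ⊗[ℂ] A) :
    ρ.embedBlock A (ρ.block A x) = x * ρ.projTensor A := by
  induction x using TensorProduct.induction_on with
  | zero => simp
  | tmul a ω =>
    rw [ρ.embedBlock_apply, ρ.block_apply, TensorProduct.map_tmul, TensorProduct.map_tmul,
      AlgHom.toLinearMap_apply, ρ.embed_toAlgHom, UnitaryIrrep.projTensor,
      Algebra.TensorProduct.tmul_mul_tmul, mul_one]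
    rfl
  | add x y hx hy => simp only [map_add, add_mul, hx, hy]

theorem UnitaryIrrep.projTensor_mul_comm (ρ : UnitaryIrrep G) (x : MonoidAlgebra ℂ G ⊗[ℂ] A) :
    ρ.projTensor A * x = x * ρ.projTensor A := by
  induction x using TensorProduct.induction_on with
  | zero => simp
  | tmul a ω =>
    rw [UnitaryIrrep.projTensor, Algebra.TensorProduct.tmul_mul_tmul,
      Algebra.TensorProduct.tmul_mul_tmul, mul_one, one_mul, ρ.proj_mul_comm]
  | add x y hx hy => simp only [mul_add, add_mul, hx, hy]

theorem UnitaryIrrep.projTensor_mul_self (ρ : UnitaryIrrep G) :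
    ρ.projTensor A * ρ.projTensor A = ρ.projTensor A := by
  rw [UnitaryIrrep.projTensor, Algebra.TensorProduct.tmul_mul_tmul, ρ.proj_mul_self, one_mul]

theorem UnitaryIrrep.block_projTensor (ρ : UnitaryIrrep G) : ρ.block A (ρ.projTensor A) = 1 := by
  rw [UnitaryIrrep.projTensor, ρ.block_apply, TensorProduct.map_tmul, AlgHom.toLinearMap_apply,
    ρ.toAlgHom_proj]
  rfl

theorem UnitaryIrrep.block_projTensor_of_not_equiv {ρ σ : UnitaryIrrep G} (h : ¬ ρ ≈ σ) :
    σ.block A (ρ.projTensor A) = 0 := by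
  rw [UnitaryIrrep.projTensor, σ.block_apply, TensorProduct.map_tmul, AlgHom.toLinearMap_apply,
    UnitaryIrrep.toAlgHom_proj_of_not_equiv h, TensorProduct.zero_tmul]

theorem UnitaryIrrep.block_mul_projTensor (ρ : UnitaryIrrep G) (x : MonoidAlgebra ℂ G ⊗[ℂ] A) :
    ρ.block A (x * ρ.projTensor A) = ρ.block A x := by
  rw [map_mul, ρ.block_projTensor, mul_one]

variable {r : UnitaryDual G → UnitaryIrrep G}

/-- The trivial block of `ℂG` is the line through `π₁`, on which `x` acts by the counit. So `ε ⊗ id`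
records the whole trivial component. -/
theorem mul_projTensor_trivialClass (hr : IsSection r) (x : MonoidAlgebra ℂ G ⊗[ℂ] A) :
    x * (r (trivialClass G)).projTensor A =
      (r (trivialClass G)).proj ⊗ₜ counitMap G A x := by
  induction x using TensorProduct.induction_on with
  | zero => simp
  | tmul a ω =>
    rw [UnitaryIrrep.projTensor, Algebra.TensorProduct.tmul_mul_tmul, mul_proj_trivialClass hr,
      mul_one, counitMap_tmul, TensorProduct.smul_tmul]
  | add x y hx hy => rw [add_mul, hx, hy, map_add, TensorProduct.tmul_add]

theorem counitMap_embedBlock (hr : IsSection r) (c : NontrivialDual G)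
    (x : Matrix (Fin (r c).dim) (Fin (r c).dim) ℂ ⊗[ℂ] A) :
    counitMap G A ((r c).embedBlock A x) = 0 := by
  induction x using TensorProduct.induction_on with
  | zero => simp
  | tmul a ω =>
    rw [UnitaryIrrep.embedBlock_apply, TensorProduct.map_tmul, counitMap_tmul, counit_embed hr,
      zero_smul]
  | add x y hx hy => rw [map_add, map_add, hx, hy, add_zero]

theorem counitMap_projTensor_trivialClass (hr : IsSection r) :
    counitMap G A ((r (trivialClass G)).projTensor A) = 1 := by
  rw [UnitaryIrrep.projTensor, counitMap_tmul, counit_proj_trivialClass hr, one_smul]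

theorem sum_projTensor_eq_one [Fintype (UnitaryDual G)] (hr : IsSection r) :
    ∑ c, (r c).projTensor A = 1 := by
  simp only [UnitaryIrrep.projTensor]
  rw [← TensorProduct.sum_tmul, sum_proj_eq_one hr]
  rfl

theorem projTensor_add_sum [Finite (UnitaryDual G)] [Fintype (NontrivialDual G)]
    (hr : IsSection r) :
    (r (trivialClass G)).projTensor A + ∑ c : NontrivialDual G, (r c).projTensor A = 1 := by
  classical
  have := Fintype.ofFinite (UnitaryDual G)
  rw [← sum_projTensor_eq_one hr, Fintype.sum_eq_add_sum_subtype_ne _ (trivialClass G)]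
  congr 1
  refine Finset.sum_congr ?_ fun _ _ => rfl
  ext; simp

/-- The decomposition of an element of `ℂG ⊗ A` into its components. -/
theorem eq_tmul_counitMap_add_sum [Finite (UnitaryDual G)] [Fintype (NontrivialDual G)]
    (hr : IsSection r) (x : MonoidAlgebra ℂ G ⊗[ℂ] A) :
    x = (r (trivialClass G)).proj ⊗ₜ counitMap G A x +
      ∑ c : NontrivialDual G, x * (r c).projTensor A := by
  rw [← mul_projTensor_trivialClass hr, ← Finset.mul_sum, ← mul_add, projTensor_add_sum hr,
    mul_one]

/-- The component of a sum of embedded blocks. -/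
theorem block_sum_embedBlock [Fintype (NontrivialDual G)] (hr : IsSection r)
    (β : ∀ c : NontrivialDual G, Matrix (Fin (r c).dim) (Fin (r c).dim) ℂ ⊗[ℂ] A)
    (c : NontrivialDual G) :
    (r c).block A (∑ c' : NontrivialDual G, (r c').embedBlock A (β c')) = β c := by
  rw [map_sum, Finset.sum_eq_single c, UnitaryIrrep.block_embedBlock]
  · intro c' _ h
    exact UnitaryIrrep.block_embedBlock_of_not_equiv
      (not_equiv_of_ne hr fun e => h (Subtype.ext e)) _
  · exact fun h => absurd (Finset.mem_univ c) h

/-- An element of `ℂG ⊗ A` is determined by its counit and its nontrivial blocks. -/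
theorem ext_blocks [Finite (UnitaryDual G)] (hr : IsSection r) {x y : MonoidAlgebra ℂ G ⊗[ℂ] A}
    (h0 : counitMap G A x = counitMap G A y)
    (h : ∀ c : NontrivialDual G, (r c).block A x = (r c).block A y) : x = y := by
  have := Fintype.ofFinite (NontrivialDual G)
  rw [eq_tmul_counitMap_add_sum hr x, eq_tmul_counitMap_add_sum hr y]
  simp only [← UnitaryIrrep.embedBlock_block, h0, h]

/-! ### Compatibility with `*`, `d`, gauge action and curvature; the two isomorphisms -/

section Star

variable {Ω : ℕ → Submodule ℂ A} [GradedAlgebra Ω] (D : StarDGA Ω)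

omit [Fintype G] in
theorem UnitaryIrrep.block_extD (ρ : UnitaryIrrep G) (x : MonoidAlgebra ℂ G ⊗[ℂ] A) :
    ρ.block A (extD _ D x) = extD _ D (ρ.block A x) := map_extD D ρ.toAlgHom.toLinearMap x

theorem UnitaryIrrep.block_tstar (ρ : UnitaryIrrep G) (x : MonoidAlgebra ℂ G ⊗[ℂ] A) :
    ρ.block A (tstar _ D x) = tstar _ D (ρ.block A x) :=
  map_tstar D ρ.toAlgHom.toLinearMap ρ.toAlgHom_star x

theorem UnitaryIrrep.block_gaugeTransform (ρ : UnitaryIrrep G)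
    (γ α : MonoidAlgebra ℂ G ⊗[ℂ] A) :
    ρ.block A (gaugeTransform D γ α) = gaugeTransform D (ρ.block A γ) (ρ.block A α) := by
  simp only [gaugeTransform, map_add, map_mul, ρ.block_tstar, ρ.block_extD]

omit [Fintype G] in
theorem UnitaryIrrep.block_curvatureForm (ρ : UnitaryIrrep G) (α : MonoidAlgebra ℂ G ⊗[ℂ] A) :
    ρ.block A (curvatureForm D α) = curvatureForm D (ρ.block A α) := by
  simp only [curvatureForm, map_add, map_mul, ρ.block_extD]

theorem counitMap_tstar (x : MonoidAlgebra ℂ G ⊗[ℂ] A) :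
    counitMap G A (tstar _ D x) = D.conj (counitMap G A x) := by
  have h : ∀ a : MonoidAlgebra ℂ G, Bialgebra.counitAlgHom ℂ (MonoidAlgebra ℂ G) (star a) =
      star (Bialgebra.counitAlgHom ℂ (MonoidAlgebra ℂ G) a) := fun a => by
    induction a using MonoidAlgebra.induction_linear with
    | zero => simp
    | add x y hx hy => simp only [map_add, star_add, hx, hy]
    | single g a => rw [star_single]; simp
  induction x using TensorProduct.induction_on with
  | zero => simp
  | tmul a ω => rw [tstar_tmul, counitMap_tmul, counitMap_tmul, LinearMap.map_smulₛₗ, h]; rfl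
  | add x y hx hy => simp only [map_add, hx, hy]

/-- The component is `ι_ρ` applied to the block of `x`, and both maps commute with `*`. This avoids
the graded sign rule and any homogeneity of `x`. -/
theorem UnitaryIrrep.tstar_mul_projTensor (ρ : UnitaryIrrep G) {x : MonoidAlgebra ℂ G ⊗[ℂ] A} :
    tstar _ D (x * ρ.projTensor A) = tstar _ D x * ρ.projTensor A := by
  rw [← ρ.embedBlock_block, ← ρ.embedBlock_block, ρ.block_tstar]
  exact (map_tstar D ρ.embed (fun a => (ρ.star_embed a).symm) _).symm

theorem UnitaryIrrep.block_mem_antiHermForms (ρ : UnitaryIrrep G) {n : ℕ}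
    {x : MonoidAlgebra ℂ G ⊗[ℂ] A} (hx : x ∈ GroupForms G D n) :
    ρ.block A x ∈ UdForms D ρ.dim n :=
  map_mem_antiHermForms D ρ.toAlgHom.toLinearMap (fun _ _ => Submodule.mem_top) ρ.toAlgHom_star hx

theorem embedBlock_mem_groupForms (hr : IsSection r) (c : NontrivialDual G) {n : ℕ}
    {x : Matrix (Fin (r c).dim) (Fin (r c).dim) ℂ ⊗[ℂ] A} (hx : x ∈ UdForms D (r c).dim n) :
    (r c).embedBlock A x ∈ GroupForms G D n :=
  map_mem_antiHermForms D (r c).embed (fun a _ => counit_embed hr c a)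
    (fun a => ((r c).star_embed a).symm) hx

theorem UnitaryIrrep.block_mem_unitaryGauge (ρ : UnitaryIrrep G) {x : MonoidAlgebra ℂ G ⊗[ℂ] A}
    (hx : x ∈ unitaryGauge (MonoidAlgebra ℂ G) D) : ρ.block A x ∈ UdGauge D ρ.dim := by
  rw [mem_unitaryGauge] at hx ⊢
  refine ⟨map_mem_valForms ρ.toAlgHom.toLinearMap (fun _ _ => Submodule.mem_top) hx.1, ?_, ?_⟩
  · rw [← ρ.block_tstar, ← map_mul, hx.2.1, map_one]
  · rw [← ρ.block_tstar, ← map_mul, hx.2.2, map_one]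

theorem counitMap_eq_zero_of_mem_groupForms {n : ℕ} {ω : MonoidAlgebra ℂ G ⊗[ℂ] A}
    (hω : ω ∈ GroupForms G D n) : counitMap G A ω = 0 :=
  ((mem_valForms_augmentation G).1 ((mem_antiHermForms D).1 hω).1).2

variable [Finite (UnitaryDual G)]

/-- The decomposition of the anti-Hermitian `ℂG⁺`-valued forms into blocks. -/
noncomputable def formsEquiv (hr : IsSection r) (n : ℕ) :
    GroupForms G D n ≃+ ∀ c : NontrivialDual G, UdForms D (r c).dim n :=
  letI := Fintype.ofFinite (NontrivialDual G)
  { toFun := fun ω c => ⟨(r c).block A ω.1, (r c).block_mem_antiHermForms D ω.2⟩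
    invFun := fun β => ⟨∑ c : NontrivialDual G, (r c).embedBlock A (β c).1,
      sum_mem fun c _ => embedBlock_mem_groupForms D hr c (β c).2⟩
    -- Both sides have vanishing trivial block: the glued form because `embed` lands in `ℂG⁺`, the
    -- form `ω` by assumption.
    left_inv := fun ω => Subtype.ext <| ext_blocks hr
      (by
        rw [map_sum, counitMap_eq_zero_of_mem_groupForms D ω.2]
        exact Finset.sum_eq_zero fun c _ => counitMap_embedBlock hr c _)
      (block_sum_embedBlock hr _)
    right_inv := fun β => funext fun c => Subtype.ext (block_sum_embedBlock hr _ c)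
    map_add' := fun ω η => funext fun c => Subtype.ext (map_add ((r c).block A) ω.1 η.1) }

theorem formsEquiv_symm_apply (hr : IsSection r) (n : ℕ)
    (β : ∀ c : NontrivialDual G, UdForms D (r c).dim n) :
    ((formsEquiv D hr n).symm β).1 = ∑ᶠ c : NontrivialDual G, (r c).embedBlock A (β c).1 := by
  let := Fintype.ofFinite (NontrivialDual G)
  rw [finsum_eq_sum_of_fintype]
  rfl

/-- The element `π₁ ⊗ 1 + ∑_ρ (ι_ρ ⊗ id) u_ρ` of `ℂG ⊗ A` glued from blocks. -/
noncomputable def glueBlocks (r : UnitaryDual G → UnitaryIrrep G)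
    (u : ∀ c : NontrivialDual G, Matrix (Fin (r c).dim) (Fin (r c).dim) ℂ ⊗[ℂ] A) :
    MonoidAlgebra ℂ G ⊗[ℂ] A :=
  (r (trivialClass G)).projTensor A + ∑ᶠ c : NontrivialDual G, (r c).embedBlock A (u c)

theorem block_glueBlocks (hr : IsSection r)
    (u : ∀ c : NontrivialDual G, Matrix (Fin (r c).dim) (Fin (r c).dim) ℂ ⊗[ℂ] A)
    (c : NontrivialDual G) : (r c).block A (glueBlocks r u) = u c := by
  let := Fintype.ofFinite (NontrivialDual G)
  rw [glueBlocks, finsum_eq_sum_of_fintype, map_add, block_sum_embedBlock hr,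
    UnitaryIrrep.block_projTensor_of_not_equiv (not_equiv_of_ne hr c.2.symm), zero_add]

theorem counitMap_glueBlocks (hr : IsSection r)
    (u : ∀ c : NontrivialDual G, Matrix (Fin (r c).dim) (Fin (r c).dim) ℂ ⊗[ℂ] A) :
    counitMap G A (glueBlocks r u) = 1 := by
  let := Fintype.ofFinite (NontrivialDual G)
  rw [glueBlocks, finsum_eq_sum_of_fintype, map_add, counitMap_projTensor_trivialClass hr, map_sum,
    Finset.sum_eq_zero fun c _ => counitMap_embedBlock hr c _, add_zero]

theorem glueBlocks_mem_valForms
    (u : ∀ c : NontrivialDual G, Matrix (Fin (r c).dim) (Fin (r c).dim) ℂ ⊗[ℂ] A)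
    (hu : ∀ c : NontrivialDual G,
      u c ∈ valForms Ω (⊤ : Submodule ℂ (Matrix (Fin (r c).dim) (Fin (r c).dim) ℂ)) 0) :
    glueBlocks r u ∈ valForms Ω (⊤ : Submodule ℂ (MonoidAlgebra ℂ G)) 0 := by
  let := Fintype.ofFinite (NontrivialDual G)
  rw [glueBlocks, finsum_eq_sum_of_fintype]
  exact add_mem (tmul_mem_valForms Submodule.mem_top SetLike.GradedOne.one_mem)
    (sum_mem fun c _ => map_mem_valForms (r c).embed (fun _ _ => Submodule.mem_top) (hu c))

/-- By `ext_blocks`, unitarity can be tested under `ε ⊗ id` and in each nontrivial block. These maps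
are multiplicative and compatible with `*`, and they send the glued element to 1 and to the given
unitaries. The summand `π₁ ⊗ 1` provides the value 1. -/
theorem glueBlocks_mem_unitaryGauge (hr : IsSection r)
    (u : ∀ c : NontrivialDual G, UdGauge D (r c).dim) :
    glueBlocks r (fun c => (u c).1) ∈ unitaryGauge (MonoidAlgebra ℂ G) D := by
  have hu := fun c : NontrivialDual G => (mem_unitaryGauge _ D).1 (u c).2
  refine (mem_unitaryGauge _ D).2 ⟨glueBlocks_mem_valForms _ fun c => (hu c).1, ?_, ?_⟩
  · refine ext_blocks hr ?_ fun c => ?_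
    · rw [map_mul, counitMap_tstar, counitMap_glueBlocks hr, conj_one, one_mul, map_one]
    · rw [map_mul, UnitaryIrrep.block_tstar, block_glueBlocks hr, (hu c).2.1, map_one]
  · refine ext_blocks hr ?_ fun c => ?_
    · rw [map_mul, counitMap_tstar, counitMap_glueBlocks hr, conj_one, one_mul, map_one]
    · rw [map_mul, UnitaryIrrep.block_tstar, block_glueBlocks hr, (hu c).2.2, map_one]

/-- The decomposition of the `ℂG`-valued gauge transformations into blocks. -/
noncomputable def gaugeEquiv (hr : IsSection r) :
    GroupGauge G D ≃* ∀ c : NontrivialDual G, UdGauge D (r c).dim where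
  toFun γ c := ⟨(r c).block A γ.1.1, (r c).block_mem_unitaryGauge D γ.1.2⟩
  invFun u := ⟨⟨glueBlocks r fun c => (u c).1, glueBlocks_mem_unitaryGauge D hr u⟩,
    counitMap_glueBlocks hr _⟩
  left_inv γ := Subtype.ext <| Subtype.ext <| ext_blocks hr
    ((counitMap_glueBlocks hr _).trans (Eq.symm γ.2)) (block_glueBlocks hr _)
  right_inv _ := funext fun c => Subtype.ext (block_glueBlocks hr _ c)
  map_mul' γ δ := funext fun c => Subtype.ext (map_mul ((r c).block A) γ.1.1 δ.1.1)

end Star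
end Blocks
end NCGauge

/-! ### The product decomposition of the gauge theory -/

open NCGauge in
theorem mainTheorem1 {G : Type*} [Group G] [Fintype G]
    {A : Type*} [Ring A] [Algebra ℂ A] {Ω : ℕ → Submodule ℂ A} [GradedAlgebra Ω] (D : StarDGA Ω)
    -- a choice of one unitary irrep in every equivalence class
    (r : UnitaryDual G → UnitaryIrrep G)
    (hr : ∀ c : UnitaryDual G, (Quotient.mk (unitaryIrrepSetoid G) (r c) : UnitaryDual G) = c) :
    Finite (UnitaryDual G) ∧
    -- the `π_ρ` are self-adjoint central orthogonal projections that add up to 1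
    (∀ c, (r c).proj ∈ Subalgebra.center ℂ (MonoidAlgebra ℂ G) ∧ star (r c).proj = (r c).proj ∧
      (r c).proj * (r c).proj = (r c).proj) ∧
    (∀ c c', c ≠ c' → (r c).proj * (r c').proj = 0) ∧
    ∑ᶠ c, (r c).proj = 1 ∧
    Bialgebra.counitAlgHom ℂ (MonoidAlgebra ℂ G) (r (trivialClass G)).proj = 1 ∧
    (∀ c : NontrivialDual G, Bialgebra.counitAlgHom ℂ (MonoidAlgebra ℂ G) (r c).proj = 0) ∧
    -- each `ρ` is a `*`-homomorphism, is inverted on `(ℂG) π_ρ` by `embed`, and vanishes on the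
    -- other components
    (∀ c x, (r c).toAlgHom (star x) = star ((r c).toAlgHom x)) ∧
    (∀ c a, (r c).toAlgHom ((r c).embed a) = a) ∧
    (∀ c x, (r c).embed ((r c).toAlgHom x) = x * (r c).proj) ∧
    (∀ c c' x, c ≠ c' → (r c').toAlgHom (x * (r c).proj) = 0) ∧
    -- decomposition of the forms, in particular of the connections (`n = 1`)
    (∀ (n : ℕ), ∀ ω ∈ GroupForms G D n,
      ω * (r (trivialClass G)).projTensor A = 0 ∧
      ω = ∑ᶠ c : NontrivialDual G, ω * (r c).projTensor A ∧
      ∀ c : NontrivialDual G, ω * (r c).projTensor A ∈ GroupForms G D n ∧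
        (r c).block A (ω * (r c).projTensor A) = (r c).block A ω) ∧
    -- decomposition of the gauge transformations
    (∀ γ : GroupGauge G D,
      γ.1.1 * (r (trivialClass G)).projTensor A = (r (trivialClass G)).projTensor A ∧
      γ.1.1 = (r (trivialClass G)).projTensor A +
        ∑ᶠ c : NontrivialDual G, γ.1.1 * (r c).projTensor A ∧
      ∀ c : NontrivialDual G,
        (γ.1.1 * (r c).projTensor A) * tstar _ D (γ.1.1 * (r c).projTensor A) =
          (r c).projTensor A ∧
        tstar _ D (γ.1.1 * (r c).projTensor A) * (γ.1.1 * (r c).projTensor A) =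
          (r c).projTensor A ∧
        (r c).block A (γ.1.1 * (r c).projTensor A) = (r c).block A γ.1.1) ∧
    -- the blocks identify the `ℂG`-valued gauge theory with the product of the `U(d_ρ)`-gauge
    -- theories over the nontrivial `ρ`
    ∃ (Φ : ∀ n : ℕ, GroupForms G D n ≃+ ∀ c : NontrivialDual G, UdForms D (r c).dim n)
      (Ψ : GroupGauge G D ≃* ∀ c : NontrivialDual G, UdGauge D (r c).dim),
      (∀ n ω c, (Φ n ω c).1 = (r c).block A ω.1) ∧
      (∀ n β, ((Φ n).symm β).1 = ∑ᶠ c : NontrivialDual G, (r c).embedBlock A (β c).1) ∧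
      (∀ γ c, (Ψ γ c).1 = (r c).block A γ.1.1) ∧
      (∀ u, (Ψ.symm u).1.1 = (r (trivialClass G)).projTensor A +
        ∑ᶠ c : NontrivialDual G, (r c).embedBlock A (u c).1) ∧
      (∀ (γ : GroupGauge G D) (α : GroupConnection G D) (c : NontrivialDual G),
        Φ 1 (γ • α) c = Ψ γ c • (Φ 1 α c : UdConnection D (r c).dim)) ∧
      (∀ (α : GroupConnection G D) (c : NontrivialDual G),
        Φ 2 (groupCurvature G D α) c = udCurvature D (r c).dim (Φ 1 α c)) := by
  have hs : IsSection r := hr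
  -- Finiteness comes first: `∑ᶠ` is 0 by convention on infinite support, and here it becomes an
  -- honest finite sum.
  have hfin := finite_unitaryDual hs
  let := Fintype.ofFinite (UnitaryDual G)
  let := Fintype.ofFinite (NontrivialDual G)
  refine ⟨hfin, fun c => ⟨Subalgebra.mem_center_iff.2 fun x => ((r c).proj_mul_comm x).symm,
    (r c).star_proj, (r c).proj_mul_self⟩,
    fun c c' h => UnitaryIrrep.proj_mul_proj (not_equiv_of_ne hs h),
    (finsum_eq_sum_of_fintype _).trans (sum_proj_eq_one hs), counit_proj_trivialClass hs,
    counit_proj hs, fun c => (r c).toAlgHom_star, fun c => (r c).toAlgHom_embed,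
    fun c => (r c).embed_toAlgHom, fun c c' x h => ?_, fun n ω hω => ?_, fun γ => ?_,
    formsEquiv D hs, gaugeEquiv D hs, fun _ _ _ => rfl, formsEquiv_symm_apply D hs,
    fun _ _ => rfl, fun _ => rfl,
    fun γ α c => Subtype.ext ((r c).block_gaugeTransform D γ.1.1 α.1),
    fun α c => Subtype.ext ((r c).block_curvatureForm D α.1)⟩
  · rw [map_mul, UnitaryIrrep.toAlgHom_proj_of_not_equiv (not_equiv_of_ne hs h), mul_zero]
  · have h0 := counitMap_eq_zero_of_mem_groupForms D hω
    refine ⟨?_, ?_, fun c => ⟨?_, (r c).block_mul_projTensor ω⟩⟩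
    · rw [mul_projTensor_trivialClass hs, h0, TensorProduct.tmul_zero]
    · have h := eq_tmul_counitMap_add_sum hs ω
      rwa [h0, TensorProduct.tmul_zero, zero_add, ← finsum_eq_sum_of_fintype] at h
    -- The component is the embedded block of `ω`, so membership follows from that of the block.
    · rw [← UnitaryIrrep.embedBlock_block]
      exact embedBlock_mem_groupForms D hs c ((r c).block_mem_antiHermForms D hω)
  · have h0 : counitMap G A γ.1.1 = 1 := γ.2
    obtain ⟨-, h1, h2⟩ := (mem_unitaryGauge _ D).1 γ.1.2
    refine ⟨?_, ?_, fun c => ⟨?_, ?_, (r c).block_mul_projTensor _⟩⟩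
    · rw [mul_projTensor_trivialClass hs, h0, UnitaryIrrep.projTensor]
    · have h := eq_tmul_counitMap_add_sum hs γ.1.1
      rwa [h0, ← finsum_eq_sum_of_fintype] at h
    -- As `π_ρ ⊗ 1` is central and idempotent, the two factors of it merge, leaving `γ γ* = 1` times
    -- `π_ρ ⊗ 1`.
    · rw [UnitaryIrrep.tstar_mul_projTensor, mul_assoc, ← mul_assoc _ (tstar _ D _),
        UnitaryIrrep.projTensor_mul_comm, mul_assoc, UnitaryIrrep.projTensor_mul_self, ← mul_assoc,
        h1, one_mul]
    · rw [UnitaryIrrep.tstar_mul_projTensor, mul_assoc, ← mul_assoc _ γ.1.1,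
        UnitaryIrrep.projTensor_mul_comm, mul_assoc, UnitaryIrrep.projTensor_mul_self, ← mul_assoc,
        h2, one_mul]
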